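/- **Theorem (Correctness of the HoTT interpretation).** Let $\mathcal L$ be an essentially finite $h$-signature; for instance, let $\mathcal L$ be (the underlying $h$-signature of) any essentially finite $\mathrm{FOL}_{\cong}$-signature. If $\mathcal S$ is a derivable judgment of the logical type theory $LTT_{\mathcal L}$, then its interpretation $[\![\mathcal S]\!]$ is a derivable judgment of HoTT. The notions are as follows. *Signatures.* Sort symbols are generated by non-logical symbols and by $\cong_K$ (isomorphism), $\rho_K$ (reflexivity), $\tau_f$ (transport), for $K$ a sort symbol and $f$ an arrow symbol; arrow symbols are generated by non-logical symbols and by $s_K,t_K$, $r_K$, $f_1,f_2,e_f$. A *FOLDS signature* is a category $\mathcal L$ whose objects (called sorts) and non-identity arrows are such symbols, which is skeletal and has no non-identity endomorphisms, and in which the set $K/\!/\mathcal L$ of non-identity arrows out of each sort $K$ is finite, together with a strict partial order on sorts such that $K_f<K$ for each non-identity $f\colon K\to K_f$ and a strict partial order on arrows such that $K_f<K_g$ implies $f<g$; the orders are total on the set $NL(\mathcal L)$ of non-logical sorts and on each $K/\!/\mathcal L$, and tuples indexed by these sets are listed in increasing order. An arrow is *top-level* if it is not an identity and not a composite of two non-identity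 arrows; $\mathrm{Top}(K)$ is the set of top-level arrows out of $K$. An *$h$-signature* is a FOLDS signature with a function $h\colon \mathrm{ob}\,\mathcal L\to\mathbb N\cup\{\infty\}$ such that (with $\infty-m=\infty$): 1. if $\cong_K\in\mathcal L$, then $K\in\mathcal L$, $h(K)\ge 2$, $\mathrm{Top}(\cong_K)=\{s_K,t_K\}=\mathcal L(\cong_K,K)$, $f s_K=f t_K$ for all $f\in K/\!/\mathcal L$, and $h(\cong_K)=h(K)-1$; 2. if $\rho_K\in\mathcal L$, then $K\in\mathcal L$, $h(K)\ge2$, $\mathrm{Top}(\rho_K)=\{r_K\}=\mathcal L(\rho_K,\cong_K)$, $s_Kr_K=t_Kr_K$, and $h(\rho_K)=h(K)-2$; 3. if $\tau_f\in\mathcal L$, then $f\colon A\to K$ is a top-level arrow of $\mathcal L$, $h(K)\ge2$, $\mathrm{Top}(\tau_f)=\{e_f,f_1,f_2\}$ with $e_f\colon\tau_f\to\,\cong_K$ and $f_1,f_2\colon\tau_f\to A$, $s_Ke_f=ff_1$, $t_Ke_f=ff_2$, $gf_1=gf_2$ for all $g\in A/\!/\mathcal L$ with $g\ne f$, $qff_1=qff_2$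 for all $q\in K/\!/\mathcal L$, and $h(\tau_f)=h(A)-1$; 4. $h(K)=0$ only if $K$ is a reflexivity or a transport sort. It is *essentially finite* if $NL(\mathcal L)$ is finite. A $\mathrm{FOL}_{\cong}$-signature is an $h$-signature that has all the logical sorts $\cong_K,\rho_K,\tau_f$ allowed by its $h$-levels. *The theory $LTT_{\mathcal L}$.* Sort expressions are $A(x_f)_{f\in A/\!/\mathcal L}$, for $A\in\mathcal L$ and variables $x_f$; contexts are lists of declarations $x\colon K$; formulas are generated by $\bot,\top,\wedge,\vee,\to,\forall x\colon K,\exists x\colon K$. The judgments are $\Gamma\ \mathbf{ok}$, $\Gamma\vdash K\ \mathbf{Sort}$, $\Gamma\vdash x\colon K$ and $\Gamma\vdash\phi\ \mathbf{formula}$. The rules are: $\varnothing\ \mathbf{ok}$; extension of a context by a fresh variable of a well-formed sort; weakening for sorts and formulas; $\Gamma,x\colon K,\Delta\vdash x\colon K$ if that context is well-formed; for each sort $K$ (logical or not) $K$-formation: $\Gamma\vdash K(x_f)_{f}\ \mathbf{Sort}$ if $\Gamma\ \mathbf{ok}$ and $\Gamma\vdash x_f\colon K_f(x_{pf})_{p\in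 K_f/\!/\mathcal L}$ for all $f\in K/\!/\mathcal L$; and the usual formation rules for the connectives and quantifiers. *HoTT* is intensional Martin-Löf type theory with judgments $\Gamma\ \mathbf{ok}$, $\Gamma\vdash A\ \mathbf{Type}$, $\Gamma\vdash A\equiv B\ \mathbf{Type}$, $\Gamma\vdash a\colon A$, $\Gamma\vdash a\equiv b\colon A$, with the types $\Pi,\Sigma,\mathtt{Id},\mathbf 1,\mathbf 0,+$, propositional truncation $\|{-}\|$, and a universe $\mathcal U$ à la Tarski (with decoding $\mathtt{El}$, closed under these type formers) satisfying the univalence axiom. $\mathcal U^{m}$ is the type of types in $\mathcal U$ of $h$-level $m$, with $\mathcal U^\infty=\mathcal U$; a term of $\mathcal U^m$ is conflated with its first projection. $\mathtt{trans}_p^{x.P}(t)\colon P[b/x]$ is the transport of $t\colon P[a/x]$ along $p\colon\mathtt{Id}(a,b)$. *The interpretation.* For an interpretation of the non-logical sorts $N$ by terms $N^{\mathcal M}$ and for terms $(a_f)_{f\in K/\!/\mathcal L}$, the type $[\![K(a_f)_f]\!]$ is defined by recursion on the sort $K$: $$ \begin{aligned} K(\mathbf a)&\mapsto \mathtt{El}\bigl(\mathtt{app}[K^{\mathcal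 M}(\mathbf a)]\bigr)\qquad (K\in NL(\mathcal L)),\\ \cong_K(\mathbf a)&\mapsto \mathtt{Id}_{[\![K(a_{ps_K})_p]\!]}(a_{s_K},a_{t_K}),\\ \rho_K(\mathbf a)&\mapsto \mathtt{Id}_{\mathtt{Id}_{[\![K(a_{ps_Kr_K})_p]\!]}(a_{s_Kr_K},a_{t_Kr_K})}(a_{r_K},\mathtt{refl}_{a_{s_Kr_K}}),\\ \tau_h(\mathbf a)&\mapsto \mathtt{Id}_{[\![A(a_{ph_2})_p]\!]}\bigl(a_{h_2},\ \mathtt{trans}_{a_{e_h}}^{y.[\![A(\mathbf a')]\!]}(a_{h_1})\bigr)\qquad(h\colon A\to K), \end{aligned} $$ where $a'_h=y$ is a new variable and $a'_p=a_{ph_1}$ for $p\in A/\!/\mathcal L$, $p\neq h$, the transport being from $a_{hh_1}$ to $a_{hh_2}$; here $\mathtt{app}[k(\mathbf a)]$ is the iterated application of $k$ to the $a_f$ (to $*\colon\mathbf 1$ if there are none). The type of homotopy $\mathcal L$-structures is $$\mathrm{HStruc}(\mathcal L)=\sum_{K\in NL(\mathcal L)}(K\colon T_K),\qquad T_K=\prod_{f\in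 K/\!/\mathcal L}\bigl(f\colon [\![K_f(pf)_{p\in K_f/\!/\mathcal L}]\!]\bigr)\ \mathcal U^{h(K)},$$ with the sort and arrow symbols serving as variables, $T_K=\mathbf 1\to\mathcal U^{h(K)}$ if $K/\!/\mathcal L=\varnothing$, and the empty sum being $\mathbf 0$. Contexts are interpreted by $[\![\varnothing]\!]=(\mathcal M\colon\mathrm{HStruc}(\mathcal L))$ and $[\![\Gamma,x\colon K]\!]=[\![\Gamma]\!],x\colon[\![K]\!]$, with $K^{\mathcal M}$ the component of $\mathcal M$ at $K$. Formulas are interpreted by $\bot\mapsto\mathbf 0$, $\top\mapsto\mathbf 1$, $\phi\wedge\psi\mapsto[\![\phi]\!]\times[\![\psi]\!]$, $\phi\vee\psi\mapsto\|[\![\phi]\!]+[\![\psi]\!]\|$, $\phi\to\psi\mapsto[\![\phi]\!]\to[\![\psi]\!]$, $\forall x\colon K.\phi\mapsto\Pi(x\colon[\![K]\!])\,[\![\phi]\!]$, $\exists x\colon K.\phi\mapsto\|\Sigma(x\colon[\![K]\!])\,[\![\phi]\!]\|$. The judgments $\Gamma\ \mathbf{ok}$, $\Gamma\vdash K\ \mathbf{Sort}$,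 $\Gamma\vdash x\colon K$, $\Gamma\vdash\phi\ \mathbf{formula}$ are sent to $[\![\Gamma]\!]\ \mathbf{ok}$, $[\![\Gamma]\!]\vdash[\![K]\!]\ \mathbf{Type}$, $[\![\Gamma]\!]\vdash x\colon[\![K]\!]$, $[\![\Gamma]\!]\vdash[\![\phi]\!]\ \mathbf{Type}$. -/

import Mathlib

/-! # Homotopy type theory

Raw expressions with de Bruijn indices (so expressions are taken up to renaming of bound variables),
contexts as lists of expressions whose head is the most recent declaration, and a derivability
predicate on judgments: intensional Martin-Löf type theory with `Π`, `Σ`, `Id`, `1`, `0`, `+`,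
a univalent universe à la Tarski and propositional truncation. -/

namespace HoTT

/-- Raw type and term expressions. The number of variables bound in an argument is indicated. -/
inductive Expr : Type
  | var (i : ℕ)
  /-- the universe `U` and its reflector `El` -/
  | univ
  | el (a : Expr)
  /-- `Π (x : A), B`, with `B` binding one variable -/
  | pi (A B : Expr)
  | lam (A b : Expr)
  | app (f a : Expr)
  /-- `Σ (x : A), B`, with `B` binding one variable -/
  | sigma (A B : Expr)
  | pair (a b : Expr)
  | fst (p : Expr)
  | snd (p : Expr)
  /-- `Id_A (a, b)` -/
  | id (A a b : Expr)
  | refl (a : Expr)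
  /-- path induction; the motive `C` binds `x, y, p` and `d` binds one variable -/
  | idrec (C d a b p : Expr)
  | unit
  | star
  /-- induction on `1`; the motive `C` binds one variable -/
  | unitrec (C c t : Expr)
  | empty
  /-- induction on `0`; the motive `C` binds one variable -/
  | emptyrec (C t : Expr)
  | sum (A B : Expr)
  | inl (a : Expr)
  | inr (b : Expr)
  /-- induction on `A + B`; `C`, `l`, `r` bind one variable each -/
  | sumrec (C l r t : Expr)
  /-- propositional truncation `‖A‖`, its point and path constructors, and its recursor:
  `truncrec B q f t : B` for `q` a proof that `B` is a mere proposition, `f : A → B`, `t : ‖A‖` -/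
  | trunc (A : Expr)
  | tin (a : Expr)
  | squash (a b : Expr)
  | truncrec (B q f t : Expr)
  /-- codes in the universe; the second argument of `cpi` and `csigma` binds one variable -/
  | cpi (a b : Expr)
  | csigma (a b : Expr)
  | cid (a t u : Expr)
  | cunit
  | cempty
  | csum (a b : Expr)
  | ctrunc (a : Expr)
  /-- the univalence axiom -/
  | ua

namespace Expr

/-- Extension of a renaming under a binder. -/
def upr (ρ : ℕ → ℕ) : ℕ → ℕ
  | 0 => 0
  | i + 1 => ρ i + 1

def rename (ρ : ℕ → ℕ) : Expr → Expr
  | var i => var (ρ i)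
  | univ => univ
  | el a => el (a.rename ρ)
  | pi A B => pi (A.rename ρ) (B.rename (upr ρ))
  | lam A b => lam (A.rename ρ) (b.rename (upr ρ))
  | app f a => app (f.rename ρ) (a.rename ρ)
  | sigma A B => sigma (A.rename ρ) (B.rename (upr ρ))
  | pair a b => pair (a.rename ρ) (b.rename ρ)
  | fst p => fst (p.rename ρ)
  | snd p => snd (p.rename ρ)
  | id A a b => id (A.rename ρ) (a.rename ρ) (b.rename ρ)
  | refl a => refl (a.rename ρ)
  | idrec C d a b p => idrec (C.rename (upr (upr (upr ρ)))) (d.rename (upr ρ))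
      (a.rename ρ) (b.rename ρ) (p.rename ρ)
  | unit => unit
  | star => star
  | unitrec C c t => unitrec (C.rename (upr ρ)) (c.rename ρ) (t.rename ρ)
  | empty => empty
  | emptyrec C t => emptyrec (C.rename (upr ρ)) (t.rename ρ)
  | sum A B => sum (A.rename ρ) (B.rename ρ)
  | inl a => inl (a.rename ρ)
  | inr b => inr (b.rename ρ)
  | sumrec C l r t => sumrec (C.rename (upr ρ)) (l.rename (upr ρ)) (r.rename (upr ρ)) (t.rename ρ)
  | trunc A => trunc (A.rename ρ)
  | tin a => tin (a.rename ρ)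
  | squash a b => squash (a.rename ρ) (b.rename ρ)
  | truncrec B q f t => truncrec (B.rename ρ) (q.rename ρ) (f.rename ρ) (t.rename ρ)
  | cpi a b => cpi (a.rename ρ) (b.rename (upr ρ))
  | csigma a b => csigma (a.rename ρ) (b.rename (upr ρ))
  | cid a t u => cid (a.rename ρ) (t.rename ρ) (u.rename ρ)
  | cunit => cunit
  | cempty => cempty
  | csum a b => csum (a.rename ρ) (b.rename ρ)
  | ctrunc a => ctrunc (a.rename ρ)
  | ua => ua

/-- Weakening by one variable. -/
def lift (e : Expr) : Expr := e.rename Nat.succ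

/-- Extension of a substitution under a binder. -/
def ups (σ : ℕ → Expr) : ℕ → Expr
  | 0 => var 0
  | i + 1 => (σ i).lift

/-- Simultaneous (capture-avoiding) substitution. -/
def subst (σ : ℕ → Expr) : Expr → Expr
  | var i => σ i
  | univ => univ
  | el a => el (a.subst σ)
  | pi A B => pi (A.subst σ) (B.subst (ups σ))
  | lam A b => lam (A.subst σ) (b.subst (ups σ))
  | app f a => app (f.subst σ) (a.subst σ)
  | sigma A B => sigma (A.subst σ) (B.subst (ups σ))
  | pair a b => pair (a.subst σ) (b.subst σ)
  | fst p => fst (p.subst σ)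
  | snd p => snd (p.subst σ)
  | id A a b => id (A.subst σ) (a.subst σ) (b.subst σ)
  | refl a => refl (a.subst σ)
  | idrec C d a b p => idrec (C.subst (ups (ups (ups σ)))) (d.subst (ups σ))
      (a.subst σ) (b.subst σ) (p.subst σ)
  | unit => unit
  | star => star
  | unitrec C c t => unitrec (C.subst (ups σ)) (c.subst σ) (t.subst σ)
  | empty => empty
  | emptyrec C t => emptyrec (C.subst (ups σ)) (t.subst σ)
  | sum A B => sum (A.subst σ) (B.subst σ)
  | inl a => inl (a.subst σ)
  | inr b => inr (b.subst σ)
  | sumrec C l r t => sumrec (C.subst (ups σ)) (l.subst (ups σ)) (r.subst (ups σ)) (t.subst σ)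
  | trunc A => trunc (A.subst σ)
  | tin a => tin (a.subst σ)
  | squash a b => squash (a.subst σ) (b.subst σ)
  | truncrec B q f t => truncrec (B.subst σ) (q.subst σ) (f.subst σ) (t.subst σ)
  | cpi a b => cpi (a.subst σ) (b.subst (ups σ))
  | csigma a b => csigma (a.subst σ) (b.subst (ups σ))
  | cid a t u => cid (a.subst σ) (t.subst σ) (u.subst σ)
  | cunit => cunit
  | cempty => cempty
  | csum a b => csum (a.subst σ) (b.subst σ)
  | ctrunc a => ctrunc (a.subst σ)
  | ua => ua

/-- `B[a/x]` for `B` binding one variable `x`. -/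
def inst (B a : Expr) : Expr :=
  B.subst fun
    | 0 => a
    | i + 1 => var i

/-- `C[a/x, b/y, p/z]` for `C` binding the variables `x, y, z` (in this order). -/
def inst3 (C a b p : Expr) : Expr :=
  C.subst fun
    | 0 => p
    | 1 => b
    | 2 => a
    | i + 3 => var i

/-- `C[x/x, x/y, refl_x/z]`, binding the variable `x`, for `C` binding `x, y, z`. -/
def diag (C : Expr) : Expr :=
  C.subst fun
    | 0 => refl (var 0)
    | 1 => var 0
    | 2 => var 0
    | i + 3 => var (i + 1)

/-- `C[e/x]`, binding one variable, for `C` binding one variable `x` and `e` an expression in which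
one variable is bound as well. -/
def instUnder (C e : Expr) : Expr :=
  C.subst fun
    | 0 => e
    | i + 1 => var (i + 1)

/-- Non-dependent functions. -/
def arrow (A B : Expr) : Expr := pi A B.lift

/-- Non-dependent pairs. -/
def prod (A B : Expr) : Expr := sigma A B.lift

/-- `trans_p^{x.P} (t)`, the transport of `t : P[a/x]` along `p : Id (a, b)` (here `P` binds one
variable): the path induction with motive `x, y, q. P[x] → P[y]` and base case the identity function,
applied to `t`. -/
def transport (P a b p t : Expr) : Expr :=
  app
    (idrec
      (arrow
        (P.rename fun
          | 0 => 2
          | i + 1 => i + 3)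
        (P.rename fun
          | 0 => 1
          | i + 1 => i + 3))
      (lam P (var 0)) a b p)
    t

/-- The type expressing that `A` is of `h`-level `n` (contractible for `n = 0`). -/
def isOfHLevel : ℕ → Expr → Expr
  | 0, A => sigma A (pi A.lift (id A.lift.lift (var 1) (var 0)))
  | n + 1, A => pi A (pi A.lift (isOfHLevel n (id A.lift.lift (var 1) (var 0))))

/-- The type expressing that `A` is a mere proposition. -/
def isMereProp (A : Expr) : Expr := pi A (pi A.lift (id A.lift.lift (var 1) (var 0)))

open Classical in
/-- `U^m`, the types of `h`-level `m` in `U`, with `U^∞ = U`. -/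
noncomputable def typesOfHLevel (m : ℕ∞) : Expr :=
  if m = ⊤ then univ else sigma univ (isOfHLevel m.toNat (el (var 0)))

open Classical in
/-- The type underlying a term of `U^m`. -/
noncomputable def elOfHLevel (m : ℕ∞) (a : Expr) : Expr :=
  if m = ⊤ then el a else el (fst a)

/-- `f : A → B` is an equivalence: it has a right inverse and a left inverse. -/
def isEquiv (A B f : Expr) : Expr :=
  prod
    (sigma (arrow B A)
      (pi B.lift (id B.lift.lift (app f.lift.lift (app (var 1) (var 0))) (var 0))))
    (sigma (arrow B A)
      (pi A.lift (id A.lift.lift (app (var 1) (app f.lift.lift (var 0))) (var 0))))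

/-- The type of equivalences from `A` to `B`. -/
def equiv (A B : Expr) : Expr := sigma (arrow A B) (isEquiv A.lift B.lift (var 0))

/-- The identity equivalence. -/
def idEquiv (A : Expr) : Expr :=
  pair (lam A (var 0))
    (pair (pair (lam A (var 0)) (lam A (refl (var 0))))
      (pair (lam A (var 0)) (lam A (refl (var 0)))))

/-- The equivalence between `El a` and `El b` induced by `p : Id_U (a, b)`. -/
def idToEquiv (a b p : Expr) : Expr :=
  idrec (equiv (el (var 2)) (el (var 1))) (idEquiv (el (var 0))) a b p

/-- The univalence axiom for `U`: for `a, b : U` the map `Id_U (a, b) → (El a ≃ El b)` is an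
equivalence. -/
def univalence : Expr :=
  pi univ (pi univ
    (isEquiv (id univ (var 1) (var 0)) (equiv (el (var 1)) (el (var 0)))
      (lam (id univ (var 1) (var 0)) (idToEquiv (var 2) (var 1) (var 0)))))

end Expr

open _root_.HoTT.Expr

/-- Judgments: `Γ ok`, `Γ ⊢ A Type`, `Γ ⊢ A ≡ B Type`, `Γ ⊢ a : A`, `Γ ⊢ a ≡ b : A`. -/
inductive Judgment : Type
  | ok (Γ : List Expr)
  | ty (Γ : List Expr) (A : Expr)
  | tyEq (Γ : List Expr) (A B : Expr)
  | tm (Γ : List Expr) (a A : Expr)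
  | tmEq (Γ : List Expr) (a b A : Expr)

open Judgment

/-- The derivable judgments of homotopy type theory. -/
inductive Derivable : Judgment → Prop
  -- contexts, variables, weakening
  | nil : Derivable (ok [])
  | cons {Γ A} : Derivable (ok Γ) → Derivable (ty Γ A) → Derivable (ok (A :: Γ))
  | var {Γ A} : Derivable (ok (A :: Γ)) → Derivable (tm (A :: Γ) (var 0) A.lift)
  | wkTy {Γ A B} : Derivable (ok (B :: Γ)) → Derivable (ty Γ A) → Derivable (ty (B :: Γ) A.lift)
  | wkTyEq {Γ A A' B} : Derivable (ok (B :: Γ)) → Derivable (tyEq Γ A A') →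
      Derivable (tyEq (B :: Γ) A.lift A'.lift)
  | wkTm {Γ a A B} : Derivable (ok (B :: Γ)) → Derivable (tm Γ a A) →
      Derivable (tm (B :: Γ) a.lift A.lift)
  | wkTmEq {Γ a a' A B} : Derivable (ok (B :: Γ)) → Derivable (tmEq Γ a a' A) →
      Derivable (tmEq (B :: Γ) a.lift a'.lift A.lift)
  -- definitional equality
  | tyRefl {Γ A} : Derivable (ty Γ A) → Derivable (tyEq Γ A A)
  | tySymm {Γ A B} : Derivable (tyEq Γ A B) → Derivable (tyEq Γ B A)
  | tyTrans {Γ A B C} : Derivable (tyEq Γ A B) → Derivable (tyEq Γ B C) → Derivable (tyEq Γ A C)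
  | tmRefl {Γ a A} : Derivable (tm Γ a A) → Derivable (tmEq Γ a a A)
  | tmSymm {Γ a b A} : Derivable (tmEq Γ a b A) → Derivable (tmEq Γ b a A)
  | tmTrans {Γ a b c A} : Derivable (tmEq Γ a b A) → Derivable (tmEq Γ b c A) →
      Derivable (tmEq Γ a c A)
  | conv {Γ a A B} : Derivable (tm Γ a A) → Derivable (tyEq Γ A B) → Derivable (tm Γ a B)
  | convEq {Γ a b A B} : Derivable (tmEq Γ a b A) → Derivable (tyEq Γ A B) →
      Derivable (tmEq Γ a b B)
  -- dependent functions
  | piForm {Γ A B} : Derivable (ty Γ A) → Derivable (ty (A :: Γ) B) → Derivable (ty Γ (pi A B))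
  | piFormEq {Γ A A' B B'} : Derivable (ty Γ A) → Derivable (tyEq Γ A A') →
      Derivable (tyEq (A :: Γ) B B') → Derivable (tyEq Γ (pi A B) (pi A' B'))
  | piIntro {Γ A B b} : Derivable (ty Γ A) → Derivable (tm (A :: Γ) b B) →
      Derivable (tm Γ (lam A b) (pi A B))
  | piIntroEq {Γ A A' B b b'} : Derivable (ty Γ A) → Derivable (tyEq Γ A A') →
      Derivable (tmEq (A :: Γ) b b' B) → Derivable (tmEq Γ (lam A b) (lam A' b') (pi A B))
  | piElim {Γ A B f a} : Derivable (tm Γ f (pi A B)) → Derivable (tm Γ a A) →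
      Derivable (tm Γ (app f a) (B.inst a))
  | piElimEq {Γ A B f f' a a'} : Derivable (tmEq Γ f f' (pi A B)) → Derivable (tmEq Γ a a' A) →
      Derivable (tmEq Γ (app f a) (app f' a') (B.inst a))
  | piBeta {Γ A B b a} : Derivable (tm (A :: Γ) b B) → Derivable (tm Γ a A) →
      Derivable (tmEq Γ (app (lam A b) a) (b.inst a) (B.inst a))
  | piEta {Γ A B f} : Derivable (tm Γ f (pi A B)) →
      Derivable (tmEq Γ f (lam A (app f.lift (var 0))) (pi A B))
  -- dependent pairs
  | sigmaForm {Γ A B} : Derivable (ty Γ A) → Derivable (ty (A :: Γ) B) →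
      Derivable (ty Γ (sigma A B))
  | sigmaFormEq {Γ A A' B B'} : Derivable (ty Γ A) → Derivable (tyEq Γ A A') →
      Derivable (tyEq (A :: Γ) B B') → Derivable (tyEq Γ (sigma A B) (sigma A' B'))
  | sigmaIntro {Γ A B a b} : Derivable (ty (A :: Γ) B) → Derivable (tm Γ a A) →
      Derivable (tm Γ b (B.inst a)) → Derivable (tm Γ (pair a b) (sigma A B))
  | sigmaIntroEq {Γ A B a a' b b'} : Derivable (ty (A :: Γ) B) → Derivable (tmEq Γ a a' A) →
      Derivable (tmEq Γ b b' (B.inst a)) → Derivable (tmEq Γ (pair a b) (pair a' b') (sigma A B))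
  | sigmaFst {Γ A B p} : Derivable (tm Γ p (sigma A B)) → Derivable (tm Γ (fst p) A)
  | sigmaFstEq {Γ A B p p'} : Derivable (tmEq Γ p p' (sigma A B)) →
      Derivable (tmEq Γ (fst p) (fst p') A)
  | sigmaSnd {Γ A B p} : Derivable (tm Γ p (sigma A B)) → Derivable (tm Γ (snd p) (B.inst (fst p)))
  | sigmaSndEq {Γ A B p p'} : Derivable (tmEq Γ p p' (sigma A B)) →
      Derivable (tmEq Γ (snd p) (snd p') (B.inst (fst p)))
  | sigmaBetaFst {Γ A B a b} : Derivable (ty (A :: Γ) B) → Derivable (tm Γ a A) →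
      Derivable (tm Γ b (B.inst a)) → Derivable (tmEq Γ (fst (pair a b)) a A)
  | sigmaBetaSnd {Γ A B a b} : Derivable (ty (A :: Γ) B) → Derivable (tm Γ a A) →
      Derivable (tm Γ b (B.inst a)) → Derivable (tmEq Γ (snd (pair a b)) b (B.inst a))
  | sigmaEta {Γ A B p} : Derivable (tm Γ p (sigma A B)) →
      Derivable (tmEq Γ p (pair (fst p) (snd p)) (sigma A B))
  -- identity types
  | idForm {Γ A a b} : Derivable (ty Γ A) → Derivable (tm Γ a A) → Derivable (tm Γ b A) →
      Derivable (ty Γ (id A a b))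
  | idFormEq {Γ A A' a a' b b'} : Derivable (tyEq Γ A A') → Derivable (tmEq Γ a a' A) →
      Derivable (tmEq Γ b b' A) → Derivable (tyEq Γ (id A a b) (id A' a' b'))
  | idIntro {Γ A a} : Derivable (tm Γ a A) → Derivable (tm Γ (refl a) (id A a a))
  | idIntroEq {Γ A a a'} : Derivable (tmEq Γ a a' A) →
      Derivable (tmEq Γ (refl a) (refl a') (id A a a))
  | idElim {Γ A C d a b p} : Derivable (ty Γ A) →
      Derivable (ty (id A.lift.lift (var 1) (var 0) :: A.lift :: A :: Γ) C) →
      Derivable (tm (A :: Γ) d C.diag) →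
      Derivable (tm Γ a A) → Derivable (tm Γ b A) → Derivable (tm Γ p (id A a b)) →
      Derivable (tm Γ (idrec C d a b p) (C.inst3 a b p))
  | idElimEq {Γ A C C' d d' a a' b b' p p'} : Derivable (ty Γ A) →
      Derivable (tyEq (id A.lift.lift (var 1) (var 0) :: A.lift :: A :: Γ) C C') →
      Derivable (tmEq (A :: Γ) d d' C.diag) →
      Derivable (tmEq Γ a a' A) → Derivable (tmEq Γ b b' A) →
      Derivable (tmEq Γ p p' (id A a b)) →
      Derivable (tmEq Γ (idrec C d a b p) (idrec C' d' a' b' p') (C.inst3 a b p))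
  | idBeta {Γ A C d a} : Derivable (ty Γ A) →
      Derivable (ty (id A.lift.lift (var 1) (var 0) :: A.lift :: A :: Γ) C) →
      Derivable (tm (A :: Γ) d C.diag) → Derivable (tm Γ a A) →
      Derivable (tmEq Γ (idrec C d a a (refl a)) (d.inst a) (C.inst3 a a (refl a)))
  -- the unit type
  | unitForm {Γ} : Derivable (ok Γ) → Derivable (ty Γ unit)
  | unitIntro {Γ} : Derivable (ok Γ) → Derivable (tm Γ star unit)
  | unitElim {Γ C c t} : Derivable (ty (unit :: Γ) C) → Derivable (tm Γ c (C.inst star)) →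
      Derivable (tm Γ t unit) → Derivable (tm Γ (unitrec C c t) (C.inst t))
  | unitElimEq {Γ C C' c c' t t'} : Derivable (tyEq (unit :: Γ) C C') →
      Derivable (tmEq Γ c c' (C.inst star)) → Derivable (tmEq Γ t t' unit) →
      Derivable (tmEq Γ (unitrec C c t) (unitrec C' c' t') (C.inst t))
  | unitBeta {Γ C c} : Derivable (ty (unit :: Γ) C) → Derivable (tm Γ c (C.inst star)) →
      Derivable (tmEq Γ (unitrec C c star) c (C.inst star))
  -- the empty type
  | emptyForm {Γ} : Derivable (ok Γ) → Derivable (ty Γ empty)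
  | emptyElim {Γ C t} : Derivable (ty (empty :: Γ) C) → Derivable (tm Γ t empty) →
      Derivable (tm Γ (emptyrec C t) (C.inst t))
  | emptyElimEq {Γ C C' t t'} : Derivable (tyEq (empty :: Γ) C C') →
      Derivable (tmEq Γ t t' empty) →
      Derivable (tmEq Γ (emptyrec C t) (emptyrec C' t') (C.inst t))
  -- coproducts
  | sumForm {Γ A B} : Derivable (ty Γ A) → Derivable (ty Γ B) → Derivable (ty Γ (sum A B))
  | sumFormEq {Γ A A' B B'} : Derivable (tyEq Γ A A') → Derivable (tyEq Γ B B') →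
      Derivable (tyEq Γ (sum A B) (sum A' B'))
  | sumInl {Γ A B a} : Derivable (tm Γ a A) → Derivable (ty Γ B) →
      Derivable (tm Γ (inl a) (sum A B))
  | sumInlEq {Γ A B a a'} : Derivable (tmEq Γ a a' A) → Derivable (ty Γ B) →
      Derivable (tmEq Γ (inl a) (inl a') (sum A B))
  | sumInr {Γ A B b} : Derivable (ty Γ A) → Derivable (tm Γ b B) →
      Derivable (tm Γ (inr b) (sum A B))
  | sumInrEq {Γ A B b b'} : Derivable (ty Γ A) → Derivable (tmEq Γ b b' B) →
      Derivable (tmEq Γ (inr b) (inr b') (sum A B))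
  | sumElim {Γ A B C l r t} : Derivable (ty (sum A B :: Γ) C) →
      Derivable (tm (A :: Γ) l (C.instUnder (inl (var 0)))) →
      Derivable (tm (B :: Γ) r (C.instUnder (inr (var 0)))) →
      Derivable (tm Γ t (sum A B)) → Derivable (tm Γ (sumrec C l r t) (C.inst t))
  | sumElimEq {Γ A B C C' l l' r r' t t'} : Derivable (tyEq (sum A B :: Γ) C C') →
      Derivable (tmEq (A :: Γ) l l' (C.instUnder (inl (var 0)))) →
      Derivable (tmEq (B :: Γ) r r' (C.instUnder (inr (var 0)))) →
      Derivable (tmEq Γ t t' (sum A B)) →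
      Derivable (tmEq Γ (sumrec C l r t) (sumrec C' l' r' t') (C.inst t))
  | sumBetaInl {Γ A B C l r a} : Derivable (ty (sum A B :: Γ) C) →
      Derivable (tm (A :: Γ) l (C.instUnder (inl (var 0)))) →
      Derivable (tm (B :: Γ) r (C.instUnder (inr (var 0)))) →
      Derivable (tm Γ a A) →
      Derivable (tmEq Γ (sumrec C l r (inl a)) (l.inst a) (C.inst (inl a)))
  | sumBetaInr {Γ A B C l r b} : Derivable (ty (sum A B :: Γ) C) →
      Derivable (tm (A :: Γ) l (C.instUnder (inl (var 0)))) →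
      Derivable (tm (B :: Γ) r (C.instUnder (inr (var 0)))) →
      Derivable (tm Γ b B) →
      Derivable (tmEq Γ (sumrec C l r (inr b)) (r.inst b) (C.inst (inr b)))
  -- propositional truncation
  | truncForm {Γ A} : Derivable (ty Γ A) → Derivable (ty Γ (trunc A))
  | truncFormEq {Γ A A'} : Derivable (tyEq Γ A A') → Derivable (tyEq Γ (trunc A) (trunc A'))
  | truncIntro {Γ A a} : Derivable (tm Γ a A) → Derivable (tm Γ (tin a) (trunc A))
  | truncIntroEq {Γ A a a'} : Derivable (tmEq Γ a a' A) →
      Derivable (tmEq Γ (tin a) (tin a') (trunc A))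
  | truncPath {Γ A a b} : Derivable (tm Γ a (trunc A)) → Derivable (tm Γ b (trunc A)) →
      Derivable (tm Γ (squash a b) (id (trunc A) a b))
  | truncPathEq {Γ A a a' b b'} : Derivable (tmEq Γ a a' (trunc A)) →
      Derivable (tmEq Γ b b' (trunc A)) →
      Derivable (tmEq Γ (squash a b) (squash a' b') (id (trunc A) a b))
  | truncElim {Γ A B q f t} : Derivable (ty Γ B) → Derivable (tm Γ q (isMereProp B)) →
      Derivable (tm Γ f (arrow A B)) → Derivable (tm Γ t (trunc A)) →
      Derivable (tm Γ (truncrec B q f t) B)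
  | truncElimEq {Γ A B B' q q' f f' t t'} : Derivable (tyEq Γ B B') →
      Derivable (tmEq Γ q q' (isMereProp B)) → Derivable (tmEq Γ f f' (arrow A B)) →
      Derivable (tmEq Γ t t' (trunc A)) →
      Derivable (tmEq Γ (truncrec B q f t) (truncrec B' q' f' t') B)
  | truncBeta {Γ A B q f a} : Derivable (ty Γ B) → Derivable (tm Γ q (isMereProp B)) →
      Derivable (tm Γ f (arrow A B)) → Derivable (tm Γ a A) →
      Derivable (tmEq Γ (truncrec B q f (tin a)) (app f a) B)
  -- the universe
  | univForm {Γ} : Derivable (ok Γ) → Derivable (ty Γ univ)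
  | elForm {Γ a} : Derivable (tm Γ a univ) → Derivable (ty Γ (el a))
  | elFormEq {Γ a a'} : Derivable (tmEq Γ a a' univ) → Derivable (tyEq Γ (el a) (el a'))
  | cpi {Γ a b} : Derivable (tm Γ a univ) → Derivable (tm (el a :: Γ) b univ) →
      Derivable (tm Γ (cpi a b) univ)
  | cpiEq {Γ a a' b b'} : Derivable (tm Γ a univ) → Derivable (tmEq Γ a a' univ) →
      Derivable (tmEq (el a :: Γ) b b' univ) → Derivable (tmEq Γ (cpi a b) (cpi a' b') univ)
  | elPi {Γ a b} : Derivable (tm Γ a univ) → Derivable (tm (el a :: Γ) b univ) →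
      Derivable (tyEq Γ (el (cpi a b)) (pi (el a) (el b)))
  | csigma {Γ a b} : Derivable (tm Γ a univ) → Derivable (tm (el a :: Γ) b univ) →
      Derivable (tm Γ (csigma a b) univ)
  | csigmaEq {Γ a a' b b'} : Derivable (tm Γ a univ) → Derivable (tmEq Γ a a' univ) →
      Derivable (tmEq (el a :: Γ) b b' univ) → Derivable (tmEq Γ (csigma a b) (csigma a' b') univ)
  | elSigma {Γ a b} : Derivable (tm Γ a univ) → Derivable (tm (el a :: Γ) b univ) →
      Derivable (tyEq Γ (el (csigma a b)) (sigma (el a) (el b)))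
  | cid {Γ a t u} : Derivable (tm Γ a univ) → Derivable (tm Γ t (el a)) →
      Derivable (tm Γ u (el a)) → Derivable (tm Γ (cid a t u) univ)
  | cidEq {Γ a a' t t' u u'} : Derivable (tmEq Γ a a' univ) → Derivable (tmEq Γ t t' (el a)) →
      Derivable (tmEq Γ u u' (el a)) → Derivable (tmEq Γ (cid a t u) (cid a' t' u') univ)
  | elId {Γ a t u} : Derivable (tm Γ a univ) → Derivable (tm Γ t (el a)) →
      Derivable (tm Γ u (el a)) → Derivable (tyEq Γ (el (cid a t u)) (id (el a) t u))
  | cunit {Γ} : Derivable (ok Γ) → Derivable (tm Γ cunit univ)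
  | elUnit {Γ} : Derivable (ok Γ) → Derivable (tyEq Γ (el cunit) unit)
  | cempty {Γ} : Derivable (ok Γ) → Derivable (tm Γ cempty univ)
  | elEmpty {Γ} : Derivable (ok Γ) → Derivable (tyEq Γ (el cempty) empty)
  | csum {Γ a b} : Derivable (tm Γ a univ) → Derivable (tm Γ b univ) →
      Derivable (tm Γ (csum a b) univ)
  | csumEq {Γ a a' b b'} : Derivable (tmEq Γ a a' univ) → Derivable (tmEq Γ b b' univ) →
      Derivable (tmEq Γ (csum a b) (csum a' b') univ)
  | elSum {Γ a b} : Derivable (tm Γ a univ) → Derivable (tm Γ b univ) →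
      Derivable (tyEq Γ (el (csum a b)) (sum (el a) (el b)))
  | ctrunc {Γ a} : Derivable (tm Γ a univ) → Derivable (tm Γ (ctrunc a) univ)
  | ctruncEq {Γ a a'} : Derivable (tmEq Γ a a' univ) →
      Derivable (tmEq Γ (ctrunc a) (ctrunc a') univ)
  | elTrunc {Γ a} : Derivable (tm Γ a univ) → Derivable (tyEq Γ (el (ctrunc a)) (trunc (el a)))
  -- univalence
  | ua {Γ} : Derivable (ok Γ) → Derivable (tm Γ ua univalence)

end HoTT

/-! # Signatures -/

namespace FOLIso

universe u v

mutual

/-- Symbols for sorts: non-logical sorts, isomorphism sorts `≅_K`, reflexivity sorts `ρ_K` and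
transport sorts `τ_f`. -/
inductive Ob (O : Type u) (M : Type v) : Type (max u v)
  | base (A : O)
  | iso (K : Ob O M)
  | rho (K : Ob O M)
  | tau (f : Mor O M)

/-- Symbols for (non-identity) arrows: non-logical arrows, `s_K`, `t_K`, `r_K`, `f₁`, `f₂`, `e_f`. -/
inductive Mor (O : Type u) (M : Type v) : Type (max u v)
  | base (m : M)
  | src (K : Ob O M)
  | tgt (K : Ob O M)
  | rfl (K : Ob O M)
  | fst (f : Mor O M)
  | snd (f : Mor O M)
  | path (f : Mor O M)

end

/-- The non-logical sort symbols. -/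
def Ob.NonLogical {O : Type u} {M : Type v} : Ob O M → Prop
  | .base _ => True
  | _ => False

/-- A FOLDS signature over `(Ob, Mor)`: an inverse category with a proper order.

The category is given by its objects `ob` and its *non-identity* arrows `mor`, with composition
`comp g f = g ∘ f`. In an inverse category (skeletal, no non-identity endomorphisms) a composite of
two non-identity arrows is never an identity, so nothing is lost; conversely, adjoining identities to
data as below gives a skeletal category without non-identity endomorphisms. The values of `dom`,
`cod`, `comp` outside `mor` (or on non-composable arrows) carry no information. -/
structure FOLDSSignature (O : Type u) (M : Type v) where
  ob : Set (Ob O M)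
  mor : Set (Mor O M)
  dom : Mor O M → Ob O M
  cod : Mor O M → Ob O M
  comp : Mor O M → Mor O M → Mor O M
  dom_mem : ∀ f ∈ mor, dom f ∈ ob
  cod_mem : ∀ f ∈ mor, cod f ∈ ob
  comp_mem : ∀ f ∈ mor, ∀ g ∈ mor, cod f = dom g → comp g f ∈ mor
  dom_comp : ∀ f ∈ mor, ∀ g ∈ mor, cod f = dom g → dom (comp g f) = dom f
  cod_comp : ∀ f ∈ mor, ∀ g ∈ mor, cod f = dom g → cod (comp g f) = cod g
  assoc : ∀ f ∈ mor, ∀ g ∈ mor, ∀ k ∈ mor, cod f = dom g → cod g = dom k →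
    comp k (comp g f) = comp (comp k g) f
  no_endo : ∀ f ∈ mor, dom f ≠ cod f
  finite_fanout : ∀ K ∈ ob, {f ∈ mor | dom f = K}.Finite
  /-- the order on objects -/
  obLt : Ob O M → Ob O M → Prop
  obLt_irrefl : ∀ K ∈ ob, ¬ obLt K K
  obLt_trans : ∀ K ∈ ob, ∀ K' ∈ ob, ∀ K'' ∈ ob, obLt K K' → obLt K' K'' → obLt K K''
  cod_obLt_dom : ∀ f ∈ mor, obLt (cod f) (dom f)
  /-- the order on arrows -/
  morLt : Mor O M → Mor O M → Prop
  morLt_irrefl : ∀ f ∈ mor, ¬ morLt f f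
  morLt_trans : ∀ f ∈ mor, ∀ g ∈ mor, ∀ k ∈ mor, morLt f g → morLt g k → morLt f k
  morLt_of_cod : ∀ f ∈ mor, ∀ g ∈ mor, obLt (cod f) (cod g) → morLt f g
  /-- the non-logical sorts, and the arrows out of a given sort, are listed in increasing order, so
  the orders are total on these sets -/
  obLt_total : ∀ K ∈ ob, ∀ K' ∈ ob, K.NonLogical → K'.NonLogical → K ≠ K' → obLt K K' ∨ obLt K' K
  morLt_total : ∀ f ∈ mor, ∀ g ∈ mor, dom f = dom g → f ≠ g → morLt f g ∨ morLt g f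

namespace FOLDSSignature

variable {O : Type u} {M : Type v} (L : FOLDSSignature O M)

/-- `K // L`, the set of non-identity arrows with domain `K`. -/
def out (K : Ob O M) : Set (Mor O M) := {f ∈ L.mor | L.dom f = K}

/-- The non-identity arrows from `K` to `K'`. -/
def hom (K K' : Ob O M) : Set (Mor O M) := {f ∈ L.mor | L.dom f = K ∧ L.cod f = K'}

/-- The top-level arrows of `K`: those non-identity arrows with domain `K` that are not a composite of
two non-identity arrows. -/
def top (K : Ob O M) : Set (Mor O M) :=
  {f ∈ L.out K | ¬ ∃ k ∈ L.mor, ∃ g ∈ L.mor, L.cod k = L.dom g ∧ f = L.comp g k}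

/-- The set `NL(L)` of non-logical sorts. -/
def nonLogical : Set (Ob O M) := {K ∈ L.ob | K.NonLogical}

def EssentiallyFinite : Prop := L.nonLogical.Finite

/-- The number of sorts on which `K` depends. -/
noncomputable def rank (K : Ob O M) : ℕ := (L.cod '' L.out K).ncard

theorem rank_lt {f : Mor O M} (hf : f ∈ L.mor) : L.rank (L.cod f) < L.rank (L.dom f) := by
  apply Set.ncard_lt_ncard
  · refine ⟨?_, fun hsub => ?_⟩
    · rintro _ ⟨g, ⟨hg, hgd⟩, rfl⟩
      exact ⟨L.comp g f, ⟨L.comp_mem f hf g hg hgd.symm, L.dom_comp f hf g hg hgd.symm⟩,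
        L.cod_comp f hf g hg hgd.symm⟩
    · obtain ⟨g, ⟨hg, hgd⟩, hgc⟩ := hsub ⟨f, ⟨hf, rfl⟩, rfl⟩
      exact L.no_endo g hg (hgd.trans hgc.symm)
  · exact (L.finite_fanout _ (L.dom_mem f hf)).image _

end FOLDSSignature

/-- An `h`-signature. Every signature of first-order logic with isomorphism is an `h`-signature (one
that has all the logical sorts that its `h`-levels allow), with the same sorts, formulas and
structures; the closure under logical sorts plays no role below.

Subtraction in `ℕ∞` satisfies `⊤ - n = ⊤`. -/
structure HSignature (O : Type u) (M : Type v) extends FOLDSSignature O M where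
  h : Ob O M → ℕ∞
  -- isomorphism sorts
  iso_mem : ∀ K, .iso K ∈ ob → K ∈ ob
  iso_level : ∀ K, .iso K ∈ ob → 2 ≤ h K
  iso_top : ∀ K, .iso K ∈ ob → toFOLDSSignature.top (.iso K) = {.src K, .tgt K}
  iso_hom : ∀ K, .iso K ∈ ob → toFOLDSSignature.hom (.iso K) K = {.src K, .tgt K}
  iso_comp : ∀ K, .iso K ∈ ob → ∀ f ∈ toFOLDSSignature.out K, comp f (.src K) = comp f (.tgt K)
  iso_h : ∀ K, .iso K ∈ ob → h (.iso K) = h K - 1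
  -- reflexivity sorts
  rho_mem : ∀ K, .rho K ∈ ob → K ∈ ob
  rho_level : ∀ K, .rho K ∈ ob → 2 ≤ h K
  rho_top : ∀ K, .rho K ∈ ob → toFOLDSSignature.top (.rho K) = {.rfl K}
  rho_hom : ∀ K, .rho K ∈ ob → toFOLDSSignature.hom (.rho K) (.iso K) = {.rfl K}
  rho_comp : ∀ K, .rho K ∈ ob → comp (.src K) (.rfl K) = comp (.tgt K) (.rfl K)
  rho_h : ∀ K, .rho K ∈ ob → h (.rho K) = h K - 2
  -- transport sorts
  tau_mem : ∀ f, .tau f ∈ ob → f ∈ mor ∧ f ∈ toFOLDSSignature.top (dom f)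
  tau_level : ∀ f, .tau f ∈ ob → 2 ≤ h (cod f)
  tau_top : ∀ f, .tau f ∈ ob → toFOLDSSignature.top (.tau f) = {.path f, .fst f, .snd f}
  tau_path : ∀ f, .tau f ∈ ob → cod (.path f) = .iso (cod f)
  tau_fst : ∀ f, .tau f ∈ ob → cod (.fst f) = dom f
  tau_snd : ∀ f, .tau f ∈ ob → cod (.snd f) = dom f
  tau_src : ∀ f, .tau f ∈ ob → comp (.src (cod f)) (.path f) = comp f (.fst f)
  tau_tgt : ∀ f, .tau f ∈ ob → comp (.tgt (cod f)) (.path f) = comp f (.snd f)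
  tau_other : ∀ f, .tau f ∈ ob → ∀ g ∈ toFOLDSSignature.out (dom f), g ≠ f →
    comp g (.fst f) = comp g (.snd f)
  tau_base : ∀ f, .tau f ∈ ob → ∀ q ∈ toFOLDSSignature.out (cod f),
    comp q (comp f (.fst f)) = comp q (comp f (.snd f))
  tau_h : ∀ f, .tau f ∈ ob → h (.tau f) = h (dom f) - 1
  -- only reflexivity and transport sorts may have `h`-level `0`
  h_ne_zero : ∀ K ∈ ob, h K = 0 → (∃ A, K = .rho A) ∨ ∃ f, K = .tau f

open Classical in
/-- The increasing enumeration of a set on which `lt` is a total order, as a list (the empty list if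
there is none). -/
noncomputable def sortedList {α : Type*} (lt : α → α → Prop) (S : Set α) : List α :=
  if H : ∃ l : List α, l.Pairwise lt ∧ ∀ a, a ∈ l ↔ a ∈ S then H.choose else []

namespace FOLDSSignature

variable {O : Type u} {M : Type v} (L : FOLDSSignature O M)

/-- The arrows in `K // L`, in increasing order. -/
noncomputable def outList (K : Ob O M) : List (Mor O M) := sortedList L.morLt (L.out K)

/-- The non-logical sorts, in increasing order. -/
noncomputable def nonLogicalList : List (Ob O M) := sortedList L.obLt L.nonLogical

/-! # The logical type theory of a signature

Variables are de Bruijn indices; a context is a list of sorts whose head is the most recent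
declaration. Freshness of a newly declared variable is automatic, and formulas are represented up to
renaming of bound variables. -/

/-- A sort expression `A (x_f)_{f ∈ A // L}`. -/
structure SortExpr where
  head : Ob O M
  head_mem : head ∈ L.ob
  args : L.out head → ℕ

/-- Renaming of variables in a sort expression. -/
def SortExpr.rename {L : FOLDSSignature O M} (ρ : ℕ → ℕ) (K : L.SortExpr) : L.SortExpr where
  head := K.head
  head_mem := K.head_mem
  args := fun f => ρ (K.args f)

/-- For an arrow `f : K → K_f` and a family `(x_g)_{g ∈ K // L}`, the sort expression
`K_f (x_{p f})_{p ∈ K_f // L}`. -/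
def depSort {K : Ob O M} (x : L.out K → ℕ) (f : L.out K) : L.SortExpr where
  head := L.cod f
  head_mem := L.cod_mem f f.2.1
  args := fun p => x ⟨L.comp p f, L.comp_mem f f.2.1 p p.2.1 p.2.2.symm,
    (L.dom_comp f f.2.1 p p.2.1 p.2.2.symm).trans f.2.2⟩

/-- Formulas. In a quantified formula the body binds one variable. -/
inductive Formula
  | bot
  | top
  | and (φ ψ : Formula)
  | or (φ ψ : Formula)
  | imp (φ ψ : Formula)
  | all (K : L.SortExpr) (φ : Formula)
  | ex (K : L.SortExpr) (φ : Formula)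

/-- Renaming of free variables in a formula. -/
def Formula.rename {L : FOLDSSignature O M} (ρ : ℕ → ℕ) : L.Formula → L.Formula
  | bot => bot
  | top => top
  | and φ ψ => and (φ.rename ρ) (ψ.rename ρ)
  | or φ ψ => or (φ.rename ρ) (ψ.rename ρ)
  | imp φ ψ => imp (φ.rename ρ) (ψ.rename ρ)
  | all K φ => all (K.rename ρ) (φ.rename (HoTT.Expr.upr ρ))
  | ex K φ => ex (K.rename ρ) (φ.rename (HoTT.Expr.upr ρ))

/-- Judgments: `Γ ok`, `Γ ⊢ K Sort`, `Γ ⊢ x : K`, `Γ ⊢ φ formula`. -/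
inductive Judgment
  | ok (Γ : List L.SortExpr)
  | sort (Γ : List L.SortExpr) (K : L.SortExpr)
  | var (Γ : List L.SortExpr) (x : ℕ) (K : L.SortExpr)
  | formula (Γ : List L.SortExpr) (φ : L.Formula)

/-- The derivable judgments of the logical type theory of `L`. A context written `Γ, Δ` is the list
`Δ ++ Γ`, and an expression over `Γ` becomes one over `Γ, Δ` by adding the length of `Δ` to all its
variables. -/
inductive Derivable : L.Judgment → Prop
  | conEmpty : Derivable (.ok [])
  | conExt {Γ K} : Derivable (.ok Γ) → Derivable (.sort Γ K) → Derivable (.ok (K :: Γ))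
  | conWk {Γ Δ K} : Derivable (.ok (Δ ++ Γ)) → Derivable (.sort Γ K) →
      Derivable (.sort (Δ ++ Γ) (K.rename (· + Δ.length)))
  | ax {Γ Δ K} : Derivable (.ok (Δ ++ K :: Γ)) →
      Derivable (.var (Δ ++ K :: Γ) Δ.length (K.rename (· + (Δ.length + 1))))
  /-- `K`-formation (the first premise follows from the others if there are any) -/
  | sortForm {Γ K} (hK : K ∈ L.ob) (x : L.out K → ℕ) : Derivable (.ok Γ) →
      (∀ f : L.out K, Derivable (.var Γ (x f) (L.depSort x f))) →
      Derivable (.sort Γ ⟨K, hK, x⟩)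
  | formWk {Γ Δ φ} : Derivable (.ok (Δ ++ Γ)) → Derivable (.formula Γ φ) →
      Derivable (.formula (Δ ++ Γ) (φ.rename (· + Δ.length)))
  | botForm {Γ} : Derivable (.ok Γ) → Derivable (.formula Γ .bot)
  | topForm {Γ} : Derivable (.ok Γ) → Derivable (.formula Γ .top)
  | andForm {Γ φ ψ} : Derivable (.ok Γ) → Derivable (.formula Γ φ) → Derivable (.formula Γ ψ) →
      Derivable (.formula Γ (.and φ ψ))
  | orForm {Γ φ ψ} : Derivable (.ok Γ) → Derivable (.formula Γ φ) → Derivable (.formula Γ ψ) →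
      Derivable (.formula Γ (.or φ ψ))
  | impForm {Γ φ ψ} : Derivable (.ok Γ) → Derivable (.formula Γ φ) → Derivable (.formula Γ ψ) →
      Derivable (.formula Γ (.imp φ ψ))
  | allForm {Γ K φ} : Derivable (.ok Γ) → Derivable (.formula (K :: Γ) φ) →
      Derivable (.formula Γ (.all K φ))
  | exForm {Γ K φ} : Derivable (.ok Γ) → Derivable (.formula (K :: Γ) φ) →
      Derivable (.formula Γ (.ex K φ))

end FOLDSSignature

/-! # Homotopy structures and the interpretation -/

namespace HSignature

open HoTT (Expr)

variable {O : Type u} {M : Type v} (L : HSignature O M)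

/-- `app [K (a_f)_{f ∈ K // L}]` for a term `k`: the successive application of `k` to the terms `a_f`,
or to `*` if `K // L` is empty. -/
noncomputable def appArgs (K : Ob O M) (k : Expr) (a : Mor O M → Expr) : Expr :=
  match L.outList K with
  | [] => .app k .star
  | fs => fs.foldl (fun e f => .app e (a f)) k

theorem src_mem {K : Ob O M} (hK : .iso K ∈ L.ob) : .src K ∈ L.hom (.iso K) K := by
  rw [L.iso_hom K hK]; exact .inl rfl

theorem rfl_mem {K : Ob O M} (hK : .rho K ∈ L.ob) : .rfl K ∈ L.hom (.rho K) (.iso K) := by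
  rw [L.rho_hom K hK]; rfl

theorem fst_mem {f : Mor O M} (hf : .tau f ∈ L.ob) : .fst f ∈ L.hom (.tau f) (L.dom f) := by
  have h : Mor.fst f ∈ L.top (.tau f) := by rw [L.tau_top f hf]; exact .inr (.inl rfl)
  exact ⟨h.1.1, h.1.2, L.tau_fst f hf⟩

open Classical in
/-- The type expression interpreting the sort `K (a_f)_{f ∈ K // L}`, for terms `a_f`, where the
non-logical sorts are interpreted by the terms `env`. Isomorphism sorts become identity types,
reflexivity sorts become types of identifications with `refl`, and transport sorts `τ_f` become types
of identifications with a transport along the family that varies in position `f` only. (The value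
for symbols that are not sorts of `L` is irrelevant.) -/
noncomputable def sortType (K : Ob O M) (env : Ob O M → Expr) (a : Mor O M → Expr) : Expr :=
  match K with
  | .base A => .elOfHLevel (L.h (.base A)) (L.appArgs (.base A) (env (.base A)) a)
  | .iso K =>
    if _hK : .iso K ∈ L.ob then
      .id (sortType K env fun p => a (L.comp p (.src K))) (a (.src K)) (a (.tgt K))
    else .empty
  | .rho K =>
    if _hK : .rho K ∈ L.ob then
      .id
        (.id (sortType K env fun p => a (L.comp p (L.comp (.src K) (.rfl K))))
          (a (L.comp (.src K) (.rfl K))) (a (L.comp (.tgt K) (.rfl K))))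
        (a (.rfl K)) (.refl (a (L.comp (.src K) (.rfl K))))
    else .empty
  | .tau f =>
    if _hf : .tau f ∈ L.ob then
      .id (sortType (L.dom f) env fun p => a (L.comp p (.snd f)))
        (a (.snd f))
        (.transport
          (sortType (L.dom f) (fun N => (env N).lift)
            fun p => if p = f then .var 0 else (a (L.comp p (.fst f))).lift)
          (a (L.comp f (.fst f))) (a (L.comp f (.snd f))) (a (.path f)) (a (.fst f)))
    else .empty
termination_by L.rank K
decreasing_by
  · have h := L.src_mem _hK
    have := L.rank_lt h.1
    rwa [h.2.1, h.2.2] at this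
  · have h := L.rfl_mem _hK
    have h1 := L.rank_lt h.1
    have h' := L.src_mem (h.2.2 ▸ L.cod_mem _ h.1)
    have h2 := L.rank_lt h'.1
    rw [h.2.1, h.2.2] at h1
    rw [h'.2.1, h'.2.2] at h2
    exact h2.trans h1
  all_goals
    have h := L.fst_mem _hf
    have := L.rank_lt h.1
    rwa [h.2.1, h.2.2] at this

open Classical in
/-- `Π (f : K_f)_{f ∈ fs} U^m`, where the arrow symbols serve as variables: `a` records the terms
denoted by the arrow symbols declared so far. -/
noncomputable def piOut (m : ℕ∞) (env : Ob O M → Expr) (a : Mor O M → Expr) :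
    List (Mor O M) → Expr
  | [] => .typesOfHLevel m
  | f :: fs =>
    .pi (L.sortType (L.cod f) env fun p => a (L.comp p f))
      (piOut m (fun N => (env N).lift) (fun g => if g = f then .var 0 else (a g).lift) fs)

/-- The type expression `T_K`; it is `1 → U^{h(K)}` if `K // L` is empty. No arrow symbol is declared
at the outset. -/
noncomputable def familyType (K : Ob O M) (env : Ob O M → Expr) : Expr :=
  match L.outList K with
  | [] => .arrow .unit (.typesOfHLevel (L.h K))
  | fs => L.piOut (L.h K) env (fun _ => .star) fs

open Classical in
/-- `(K₁ : T_{K₁}) × ⋯ × (Kₘ : T_{Kₘ})` for a list of non-logical sorts, which serve as variables;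
the empty sum is `0`. -/
noncomputable def sigmaSorts (env : Ob O M → Expr) : List (Ob O M) → Expr
  | [] => .empty
  | [K] => L.familyType K env
  | K :: Ks =>
    .sigma (L.familyType K env)
      (sigmaSorts (fun N => if N = K then .var 0 else (env N).lift) Ks)

/-- `HStruc (L)`, the type of homotopy `L`-structures. -/
noncomputable def hStruc : Expr := L.sigmaSorts (fun _ => .star) L.nonLogicalList

open Classical in
/-- The component with label `K` of a term `t` of an iterated sum with the given labels. -/
noncomputable def projAt (K : Ob O M) : List (Ob O M) → Expr → Expr
  | [], t => t
  | [_], t => t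
  | K' :: Ks, t => if K = K' then .fst t else projAt K Ks (.snd t)

/-- `K^𝓜`, for the structure `𝓜` declared before `n` other variables. -/
noncomputable def structEnv (n : ℕ) (K : Ob O M) : Expr := projAt K L.nonLogicalList (.var n)

open Classical in
/-- The interpretation of a sort expression over a context of length `n`. -/
noncomputable def interpSort (n : ℕ) (K : L.SortExpr) : Expr :=
  L.sortType K.head (L.structEnv n)
    fun f => if hf : f ∈ L.out K.head then .var (K.args ⟨f, hf⟩) else .star

/-- The interpretation of a context: the empty context becomes `𝓜 : HStruc (L)`. -/
noncomputable def interpCtx : List L.SortExpr → List Expr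
  | [] => [L.hStruc]
  | K :: Γ => L.interpSort Γ.length K :: interpCtx Γ

/-- The interpretation of a formula over a context of length `n`. -/
noncomputable def interpFormula : ℕ → L.Formula → Expr
  | _, .bot => .empty
  | _, .top => .unit
  | n, .and φ ψ => .prod (interpFormula n φ) (interpFormula n ψ)
  | n, .or φ ψ => .trunc (.sum (interpFormula n φ) (interpFormula n ψ))
  | n, .imp φ ψ => .arrow (interpFormula n φ) (interpFormula n ψ)
  | n, .all K φ => .pi (L.interpSort n K) (interpFormula (n + 1) φ)
  | n, .ex K φ => .trunc (.sigma (L.interpSort n K) (interpFormula (n + 1) φ))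

/-- The interpretation of the judgments of the logical type theory of `L` in HoTT. -/
noncomputable def interp : L.Judgment → HoTT.Judgment
  | .ok Γ => .ok (L.interpCtx Γ)
  | .sort Γ K => .ty (L.interpCtx Γ) (L.interpSort Γ.length K)
  | .var Γ x K => .tm (L.interpCtx Γ) (.var x) (L.interpSort Γ.length K)
  | .formula Γ φ => .ty (L.interpCtx Γ) (L.interpFormula Γ.length φ)

end HSignature

end FOLIso

-- The proof is an induction on derivations in the logical type theory, strengthened by the validity
-- of the interpreted context (`interp_derivable`). The rules for connectives and quantifiers match
-- type formers of HoTT. The weakening and variable rules follow because the interpretation commutes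
-- with renaming of variables. The two substantial points are the formation of sorts and the
-- validity of the initial context `𝓜 : HStruc(L)`.
--
-- Sort formation is `sortType_ty`, by strong induction on the number of sorts on which `K` depends.
-- For a non-logical sort the increasing order makes `T_K` a well-formed telescope, so that `K^𝓜`
-- can be applied to its arguments one after the other (`foldl_app_tm`). For a logical sort, the
-- equations between composite arrows in an `h`-signature say exactly that both sides of the
-- interpreting identity type have the same type. For `τ_f`, moreover, `f` is top-level, so that no
-- other argument has a sort depending on position `f`, and this position may vary along a path
-- (`IsArgs.update`).
--
-- The initial context is valid because `T_K` mentions only sorts below `K`, so the sum over the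
-- increasing list of non-logical sorts is well-formed (`sigmaSorts_ty`), and its projections have
-- the expected types (`projAt_tm`).
--
-- Admissibility of substitution in HoTT is never needed. The interpretation commutes with
-- substitution as syntax (`sortType_subst`), and the typing of an instance is derived afresh in the
-- context at hand.

namespace HoTT

-- Substitution calculus for raw expressions

namespace Expr

theorem ups_comp_var (ρ : ℕ → ℕ) : ups (fun i => var (ρ i)) = fun i => var (upr ρ i) := by
  funext i; cases i <;> rfl

theorem rename_eq_subst (e : Expr) (ρ : ℕ → ℕ) : e.rename ρ = e.subst fun i => var (ρ i) := by
  induction e generalizing ρ <;> simp only [rename, subst, ups_comp_var, *]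

theorem ups_var : ups var = var := by
  funext i; cases i <;> rfl

theorem subst_var (e : Expr) : e.subst var = e := by
  induction e <;> simp only [subst, ups_var, *]

theorem ups_comp_upr (σ : ℕ → Expr) (ρ : ℕ → ℕ) :
    (fun i => ups σ (upr ρ i)) = ups fun i => σ (ρ i) := by
  funext i; cases i <;> rfl

theorem rename_subst (e : Expr) (ρ : ℕ → ℕ) (σ : ℕ → Expr) :
    (e.rename ρ).subst σ = e.subst fun i => σ (ρ i) := by
  induction e generalizing ρ σ <;> simp only [rename, subst, ups_comp_upr, *]

theorem rename_rename (e : Expr) (ρ ρ' : ℕ → ℕ) :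
    (e.rename ρ).rename ρ' = e.rename fun i => ρ' (ρ i) := by
  rw [rename_eq_subst _ ρ', rename_subst, ← rename_eq_subst e fun i => ρ' (ρ i)]

theorem rename_ups (σ : ℕ → Expr) (ρ : ℕ → ℕ) :
    (fun i => (ups σ i).rename (upr ρ)) = ups fun i => (σ i).rename ρ := by
  funext i
  cases i with
  | zero => rfl
  | succ i => simp only [ups, lift, rename_rename, upr]

theorem subst_rename (e : Expr) (σ : ℕ → Expr) (ρ : ℕ → ℕ) :
    (e.subst σ).rename ρ = e.subst fun i => (σ i).rename ρ := by
  induction e generalizing σ ρ <;> simp only [rename, subst, rename_ups, *]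

theorem lift_subst_ups (e : Expr) (σ : ℕ → Expr) : e.lift.subst (ups σ) = (e.subst σ).lift := by
  rw [lift, lift, rename_subst, subst_rename]; rfl

theorem subst_ups (σ τ : ℕ → Expr) :
    (fun i => (ups σ i).subst (ups τ)) = ups fun i => (σ i).subst τ := by
  funext i
  cases i with
  | zero => rfl
  | succ i => exact lift_subst_ups _ _

/-- Under a binder this needs `lift_subst_ups`, which rests on the two mixed laws `rename_subst` and
`subst_rename`. -/
theorem subst_subst (e : Expr) (σ τ : ℕ → Expr) :
    (e.subst σ).subst τ = e.subst fun i => (σ i).subst τ := by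
  induction e generalizing σ τ <;> simp only [subst, subst_ups, *]

theorem lift_eq_subst (e : Expr) : e.lift = e.subst fun i => var (i + 1) := rename_eq_subst _ _

theorem lift_inst (e a : Expr) : e.lift.inst a = e := by
  rw [lift, inst, rename_subst]; exact subst_var e

theorem arrow_subst (A B : Expr) (σ : ℕ → Expr) :
    (arrow A B).subst σ = arrow (A.subst σ) (B.subst σ) := by
  simp only [arrow, subst, lift_subst_ups]

theorem prod_subst (A B : Expr) (σ : ℕ → Expr) :
    (prod A B).subst σ = prod (A.subst σ) (B.subst σ) := by
  simp only [prod, subst, lift_subst_ups]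

theorem arrow_rename (A B : Expr) (ρ : ℕ → ℕ) :
    (arrow A B).rename ρ = arrow (A.rename ρ) (B.rename ρ) := by
  simp only [rename_eq_subst, arrow_subst]

theorem prod_rename (A B : Expr) (ρ : ℕ → ℕ) :
    (prod A B).rename ρ = prod (A.rename ρ) (B.rename ρ) := by
  simp only [rename_eq_subst, prod_subst]

theorem rename_add_zero (e : Expr) : e.rename (· + 0) = e := by
  rw [rename_eq_subst]; exact subst_var e

theorem lift_rename_add (e : Expr) (n : ℕ) : (e.rename (· + n)).lift = e.rename (· + (n + 1)) := by
  rw [lift, rename_rename]; rfl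

/-- The motive holds two renamed copies of `P` below three binders, and both renamings commute with
the extended substitution. -/
theorem transport_subst (P a b p t : Expr) (σ : ℕ → Expr) :
    (transport P a b p t).subst σ =
      transport (P.subst (ups σ)) (a.subst σ) (b.subst σ) (p.subst σ) (t.subst σ) := by
  simp only [transport, subst, arrow_subst, rename_subst, subst_rename]
  congr 4
  all_goals
    funext i
    cases i with
    | zero => rfl
    | succ i => simp only [ups, lift, rename_rename]

theorem isOfHLevel_subst (n : ℕ) (A : Expr) (σ : ℕ → Expr) :
    (isOfHLevel n A).subst σ = isOfHLevel n (A.subst σ) := by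
  induction n generalizing A σ with
  | zero => simp only [isOfHLevel, subst, lift_subst_ups]; rfl
  | succ n ih => simp only [isOfHLevel, subst, ih, lift_subst_ups]; rfl

theorem typesOfHLevel_subst (m : ℕ∞) (σ : ℕ → Expr) :
    (typesOfHLevel m).subst σ = typesOfHLevel m := by
  unfold typesOfHLevel
  split_ifs
  · rfl
  · simp only [subst, isOfHLevel_subst]; rfl

theorem elOfHLevel_subst (m : ℕ∞) (a : Expr) (σ : ℕ → Expr) :
    (elOfHLevel m a).subst σ = elOfHLevel m (a.subst σ) := by
  unfold elOfHLevel
  split_ifs <;> rfl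

end Expr

open _root_.HoTT.Expr Judgment

-- Derived rules of HoTT

namespace Derivable

theorem ok_tail {Γ : List Expr} {A : Expr} (h : Derivable (ok (A :: Γ))) : Derivable (ok Γ) := by
  cases h; assumption

/-- Inversion works because `cons` is the only rule with this conclusion. The quantifier rules of
the logic have no premise that `K` is a sort; this lemma recovers it on the side of HoTT. -/
theorem ty_head {Γ : List Expr} {A : Expr} (h : Derivable (ok (A :: Γ))) : Derivable (ty Γ A) := by
  cases h; assumption

/-- Weakening asks for validity of the extended context. Since `ok Γ` is not extracted from other
judgments over `Γ`, it is carried along as a premise. -/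
theorem arrowForm {Γ : List Expr} {A B : Expr} (hΓ : Derivable (ok Γ)) (hA : Derivable (ty Γ A))
    (hB : Derivable (ty Γ B)) : Derivable (ty Γ (arrow A B)) :=
  piForm hA (wkTy (cons hΓ hA) hB)

theorem prodForm {Γ : List Expr} {A B : Expr} (hΓ : Derivable (ok Γ)) (hA : Derivable (ty Γ A))
    (hB : Derivable (ty Γ B)) : Derivable (ty Γ (prod A B)) :=
  sigmaForm hA (wkTy (cons hΓ hA) hB)

theorem arrowElim {Γ : List Expr} {A B f a : Expr} (hf : Derivable (tm Γ f (arrow A B)))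
    (ha : Derivable (tm Γ a A)) : Derivable (tm Γ (app f a) B) := by
  simpa only [lift_inst] using piElim hf ha

/-- The type `Id_A (x, y)` of paths between the two most recently declared variables. -/
theorem pathForm {Γ : List Expr} {A : Expr} (hΓ : Derivable (ok Γ)) (hA : Derivable (ty Γ A)) :
    Derivable (ty (A.lift :: A :: Γ) (Expr.id A.lift.lift (.var 1) (.var 0))) := by
  have h₁ : Derivable (ok (A :: Γ)) := cons hΓ hA
  have h₂ : Derivable (ok (A.lift :: A :: Γ)) := cons h₁ (wkTy h₁ hA)
  exact idForm (wkTy h₂ (wkTy h₁ hA)) (wkTm h₂ (Derivable.var h₁)) (Derivable.var h₂)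

theorem isOfHLevelForm (n : ℕ) {Γ : List Expr} {A : Expr} (hΓ : Derivable (ok Γ))
    (hA : Derivable (ty Γ A)) : Derivable (ty Γ (isOfHLevel n A)) := by
  induction n generalizing Γ A with
  | zero => exact sigmaForm hA (piForm (wkTy (cons hΓ hA) hA) (pathForm hΓ hA))
  | succ n ih =>
    have h₁ : Derivable (ok (A :: Γ)) := cons hΓ hA
    exact piForm hA (piForm (wkTy h₁ hA) (ih (cons h₁ (wkTy h₁ hA)) (pathForm hΓ hA)))

theorem typesOfHLevelForm (m : ℕ∞) {Γ : List Expr} (hΓ : Derivable (ok Γ)) :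
    Derivable (ty Γ (typesOfHLevel m)) := by
  unfold typesOfHLevel
  split_ifs
  · exact univForm hΓ
  · have h : Derivable (ok (univ :: Γ)) := cons hΓ (univForm hΓ)
    exact sigmaForm (univForm hΓ) (isOfHLevelForm _ h (elForm (Derivable.var h)))

theorem elOfHLevelForm (m : ℕ∞) {Γ : List Expr} {a : Expr}
    (ha : Derivable (tm Γ a (typesOfHLevel m))) : Derivable (ty Γ (elOfHLevel m a)) := by
  unfold typesOfHLevel at ha
  unfold elOfHLevel
  split_ifs at ha ⊢
  · exact elForm ha
  · exact elForm (sigmaFst ha)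

/-- Transport in a family `P` over `A`. The two instances of `P` in the motive of the path induction
are given as premises. -/
theorem transportForm {Γ : List Expr} {A P a b p t : Expr} (hΓ : Derivable (ok Γ))
    (hA : Derivable (ty Γ A)) (hP : Derivable (ty (A :: Γ) P))
    (hP₁ : Derivable (ty (Expr.id A.lift.lift (.var 1) (.var 0) :: A.lift :: A :: Γ)
      (P.subst fun | 0 => .var 2 | i + 1 => .var (i + 3))))
    (hP₂ : Derivable (ty (Expr.id A.lift.lift (.var 1) (.var 0) :: A.lift :: A :: Γ)
      (P.subst fun | 0 => .var 1 | i + 1 => .var (i + 3))))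
    (ha : Derivable (tm Γ a A)) (hb : Derivable (tm Γ b A))
    (hp : Derivable (tm Γ p (Expr.id A a b))) (ht : Derivable (tm Γ t (P.inst a))) :
    Derivable (tm Γ (transport P a b p t) (P.inst b)) := by
  have h₁ : Derivable (ok (A :: Γ)) := cons hΓ hA
  have h₂ : Derivable (ok (A.lift :: A :: Γ)) := cons h₁ (wkTy h₁ hA)
  have h₃ := cons h₂ (pathForm hΓ hA)
  refine arrowElim ?_ ht
  -- There is no substitution rule that would turn `hP` into the two copies of `P` in the motive;
  -- this is why `hP₁` and `hP₂` are assumed.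
  have key := idElim (d := lam P (.var 0)) (C := arrow
      (P.rename fun | 0 => 2 | i + 1 => i + 3) (P.rename fun | 0 => 1 | i + 1 => i + 3))
    hA (arrowForm h₃ ?_ ?_) ?_ ha hb hp
  · have hinst : (arrow (P.rename fun | 0 => 2 | i + 1 => i + 3)
        (P.rename fun | 0 => 1 | i + 1 => i + 3)).inst3 a b p = arrow (P.inst a) (P.inst b) := by
      rw [inst3, arrow_subst, rename_subst, rename_subst, inst, inst]
      congr 2 <;> (funext i; cases i <;> rfl)
    rw [hinst] at key
    exact key
  · convert hP₁ using 2
    rw [rename_eq_subst]; congr 1; funext i; cases i <;> rfl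
  · convert hP₂ using 2
    rw [rename_eq_subst]; congr 1; funext i; cases i <;> rfl
  -- On the diagonal both copies collapse to `P` itself, so the identity function is a base case.
  · have hdiag : (arrow (P.rename fun | 0 => 2 | i + 1 => i + 3)
        (P.rename fun | 0 => 1 | i + 1 => i + 3)).diag = arrow P P := by
      rw [diag, arrow_subst, rename_subst, rename_subst]
      congr 1 <;>
      · refine Eq.trans (congrArg (Expr.subst · P) ?_) (subst_var P)
        funext i; cases i <;> rfl
    rw [hdiag]
    exact piIntro hP (Derivable.var (cons h₁ hP))

end Derivable

end HoTT

namespace FOLIso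

universe u v

open HoTT (Expr)
open HoTT.Expr

-- Increasing enumerations

theorem exists_pairwise_enumeration {α : Type*} {lt : α → α → Prop} {S : Set α} (hS : S.Finite)
    (trans : ∀ a ∈ S, ∀ b ∈ S, ∀ c ∈ S, lt a b → lt b c → lt a c)
    (total : ∀ a ∈ S, ∀ b ∈ S, a ≠ b → lt a b ∨ lt b a) :
    ∃ l : List α, l.Pairwise lt ∧ ∀ a, a ∈ l ↔ a ∈ S := by
  classical
  have := hS.fintype
  -- Sorting uses a total relation, hence the reflexive closure; since the list has no duplicates,
  -- strictness is regained at the end.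
  let r : S → S → Prop := fun a b => a = b ∨ lt a b
  have hr : IsTrans S r := ⟨by
    rintro a b c (rfl | hab) (rfl | hbc)
    · exact .inl rfl
    · exact .inr hbc
    · exact .inr hab
    · exact .inr (trans a a.2 b b.2 c c.2 hab hbc)⟩
  have ht : Std.Total r := ⟨fun a b => by
    by_cases hab : a = b
    · exact .inl (.inl hab)
    · rcases total a a.2 b b.2 (fun e => hab (Subtype.ext e)) with h | h
      · exact .inl (.inr h)
      · exact .inr (.inr h)⟩
  let l := (Finset.univ : Finset S).toList.insertionSort r
  have hperm := List.perm_insertionSort r (Finset.univ : Finset S).toList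
  have hl : l.Pairwise r := List.pairwise_insertionSort r _
  have hn : l.Nodup := hperm.nodup_iff.2 (Finset.nodup_toList _)
  refine ⟨l.map Subtype.val, List.pairwise_map.2 ?_, fun a => ?_⟩
  · exact (hl.and hn).imp fun h => h.1.resolve_left h.2
  · simp only [List.mem_map, Subtype.exists, exists_and_right, exists_eq_right]
    constructor
    · rintro ⟨h, -⟩; exact h
    · intro h
      exact ⟨h, hperm.mem_iff.2 (Finset.mem_toList.2 (Finset.mem_univ _))⟩

/-- No enumeration has to exist, as the default value `[]` has no members. The congruence lemmas can
therefore do without assuming that `K` is a sort of the signature. -/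
theorem mem_of_mem_sortedList {α : Type*} {lt : α → α → Prop} {S : Set α} {a : α}
    (h : a ∈ sortedList lt S) : a ∈ S := by
  unfold sortedList at h
  split_ifs at h with H
  · exact (H.choose_spec.2 a).1 h
  · simp at h

theorem sortedList_spec {α : Type*} {lt : α → α → Prop} {S : Set α}
    (H : ∃ l : List α, l.Pairwise lt ∧ ∀ a, a ∈ l ↔ a ∈ S) :
    (sortedList lt S).Pairwise lt ∧ ∀ a, a ∈ sortedList lt S ↔ a ∈ S := by
  unfold sortedList
  rw [dif_pos H]
  exact H.choose_spec

-- Order and dependency in a signature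

namespace FOLDSSignature

variable {O : Type u} {M : Type v} (L : FOLDSSignature O M)

theorem outList_spec {K : Ob O M} (hK : K ∈ L.ob) :
    (L.outList K).Pairwise L.morLt ∧ ∀ f, f ∈ L.outList K ↔ f ∈ L.out K :=
  sortedList_spec (exists_pairwise_enumeration (L.finite_fanout K hK)
    (fun f hf g hg k hk => L.morLt_trans f hf.1 g hg.1 k hk.1)
    (fun f hf g hg => L.morLt_total f hf.1 g hg.1 (hf.2.trans hg.2.symm)))

theorem nonLogicalList_spec (hL : L.EssentiallyFinite) :
    L.nonLogicalList.Pairwise L.obLt ∧ ∀ K, K ∈ L.nonLogicalList ↔ K ∈ L.nonLogical :=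
  sortedList_spec (exists_pairwise_enumeration hL
    (fun K hK K' hK' K'' hK'' => L.obLt_trans K hK.1 K' hK'.1 K'' hK''.1)
    (fun K hK K' hK' => L.obLt_total K hK.1 K' hK'.1 hK.2 hK'.2))

variable {L}

theorem comp_mem_out {K : Ob O M} {f p : Mor O M} (hf : f ∈ L.out K) (hp : p ∈ L.out (L.cod f)) :
    L.comp p f ∈ L.out K :=
  ⟨L.comp_mem f hf.1 p hp.1 hp.2.symm, (L.dom_comp f hf.1 p hp.1 hp.2.symm).trans hf.2⟩

/-- The target of `pf` is below that of `f`, and the order on arrows respects the order on targets.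
Hence the sort of the argument at `f` mentions only arguments listed earlier. -/
theorem comp_morLt {K : Ob O M} {f p : Mor O M} (hf : f ∈ L.out K) (hp : p ∈ L.out (L.cod f)) :
    L.morLt (L.comp p f) f := by
  apply L.morLt_of_cod _ (comp_mem_out hf hp).1 _ hf.1
  rw [L.cod_comp f hf.1 p hp.1 hp.2.symm]
  have := L.cod_obLt_dom p hp.1
  rwa [hp.2] at this

/-- The composite arrows out of the target of `f` do not occur in an increasing list that starts
with `f`. -/
theorem comp_notMem_cons {K : Ob O M} {f p : Mor O M} {fs : List (Mor O M)} (hf : f ∈ L.out K)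
    (hfs : ∀ g ∈ fs, g ∈ L.out K) (hlt : ∀ g ∈ fs, L.morLt f g) (hp : p ∈ L.out (L.cod f)) :
    L.comp p f ∉ f :: fs := by
  have hc := comp_morLt hf hp
  rintro h
  rcases List.mem_cons.1 h with h | h
  · rw [h] at hc; exact L.morLt_irrefl f hf.1 hc
  · exact L.morLt_irrefl f hf.1
      (L.morLt_trans f hf.1 _ (hfs _ h).1 f hf.1 (hlt _ h) hc)

variable (L) in
/-- The non-logical sorts that occur in the interpretation of `K`. -/
def support (K : Ob O M) : Set (Ob O M) := {N | N.NonLogical ∧ (N = K ∨ N ∈ L.cod '' L.out K)}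

/-- A sort occurring in the target of `f` is reached from `K` by `f` or by a composite with `f`. So
the domains in `T_K` involve only non-logical sorts strictly below `K`. -/
theorem support_cod_subset_image {K : Ob O M} {f : Mor O M} (hf : f ∈ L.out K) {N : Ob O M}
    (hN : N ∈ L.support (L.cod f)) : N ∈ L.cod '' L.out K := by
  obtain ⟨-, rfl | ⟨p, hp, rfl⟩⟩ := hN
  · exact ⟨f, hf, rfl⟩
  · exact ⟨L.comp p f, comp_mem_out hf hp, L.cod_comp f hf.1 p hp.1 hp.2.symm⟩

theorem support_cod_subset {K : Ob O M} {f : Mor O M} (hf : f ∈ L.out K) :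
    L.support (L.cod f) ⊆ L.support K :=
  fun _ hN => ⟨hN.1, .inr (support_cod_subset_image hf hN)⟩

theorem support_subset_nonLogical {K : Ob O M} (hK : K ∈ L.ob) : L.support K ⊆ L.nonLogical := by
  rintro N ⟨hN, rfl | ⟨f, hf, rfl⟩⟩
  · exact ⟨hK, hN⟩
  · exact ⟨L.cod_mem f hf.1, hN⟩

theorem obLt_of_mem_image {K N : Ob O M} (hN : N ∈ L.cod '' L.out K) : L.obLt N K := by
  obtain ⟨f, hf, rfl⟩ := hN
  have := L.cod_obLt_dom f hf.1
  rwa [hf.2] at this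

theorem ob_of_mem_image {K N : Ob O M} (hN : N ∈ L.cod '' L.out K) : N ∈ L.ob := by
  obtain ⟨f, hf, rfl⟩ := hN
  exact L.cod_mem f hf.1

end FOLDSSignature

open FOLDSSignature

-- Substitution and congruence for the interpretation

namespace HSignature

variable {O : Type u} {M : Type v} (L : HSignature O M)

theorem tgt_mem {K : Ob O M} (hK : .iso K ∈ L.ob) : .tgt K ∈ L.hom (.iso K) K := by
  rw [L.iso_hom K hK]; exact .inr rfl

theorem snd_mem {f : Mor O M} (hf : .tau f ∈ L.ob) : .snd f ∈ L.hom (.tau f) (L.dom f) := by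
  have h : Mor.snd f ∈ L.top (.tau f) := by rw [L.tau_top f hf]; exact .inr (.inr rfl)
  exact ⟨h.1.1, h.1.2, L.tau_snd f hf⟩

theorem path_mem {f : Mor O M} (hf : .tau f ∈ L.ob) :
    .path f ∈ L.hom (.tau f) (.iso (L.cod f)) := by
  have h : Mor.path f ∈ L.top (.tau f) := by rw [L.tau_top f hf]; exact .inl rfl
  exact ⟨h.1.1, h.1.2, L.tau_path f hf⟩

variable {L} in
theorem mem_out_of_mem_hom {K K' : Ob O M} {f : Mor O M} (hf : f ∈ L.hom K K') : f ∈ L.out K :=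
  ⟨hf.1, hf.2.1⟩

variable {L} in
theorem rank_lt_of_mem_hom {K K' : Ob O M} {f : Mor O M} (hf : f ∈ L.hom K K') :
    L.rank K' < L.rank K := by
  have := L.rank_lt hf.1
  rwa [hf.2.1, hf.2.2] at this

theorem iso_mem_of_rho_mem {K : Ob O M} (hK : .rho K ∈ L.ob) : .iso K ∈ L.ob := by
  have h := L.rfl_mem hK
  rw [← h.2.2]; exact L.cod_mem _ h.1

/-- The arrow `s_K r_K` of a reflexivity sort. -/
theorem src_rfl_mem {K : Ob O M} (hK : .rho K ∈ L.ob) :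
    L.comp (.src K) (.rfl K) ∈ L.hom (.rho K) K := by
  have hr := L.rfl_mem hK
  have hs := L.src_mem (L.iso_mem_of_rho_mem hK)
  have e : L.cod (.rfl K) = L.dom (.src K) := hr.2.2.trans hs.2.1.symm
  exact ⟨L.comp_mem _ hr.1 _ hs.1 e, (L.dom_comp _ hr.1 _ hs.1 e).trans hr.2.1,
    (L.cod_comp _ hr.1 _ hs.1 e).trans hs.2.2⟩

theorem appArgs_subst (K : Ob O M) (k : Expr) (a : Mor O M → Expr) (σ : ℕ → Expr) :
    (L.appArgs K k a).subst σ = L.appArgs K (k.subst σ) fun f => (a f).subst σ := by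
  have key : ∀ (fs : List (Mor O M)) (k : Expr),
      (fs.foldl (fun e f => Expr.app e (a f)) k).subst σ =
        fs.foldl (fun e f => Expr.app e ((a f).subst σ)) (k.subst σ) := by
    intro fs
    induction fs with
    | nil => intro k; rfl
    | cons f fs ih => intro k; exact ih _
  unfold appArgs
  split
  · rfl
  · exact key _ _

/-- Interpretation of sorts commutes with substitution. -/
theorem sortType_subst (K : Ob O M) (env : Ob O M → Expr) (a : Mor O M → Expr) (σ : ℕ → Expr) :
    (L.sortType K env a).subst σ =
      L.sortType K (fun N => (env N).subst σ) fun f => (a f).subst σ := by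
  induction hr : L.rank K using Nat.strong_induction_on generalizing K env a σ with
  | _ r ih =>
  subst hr
  cases K with
  | base A =>
    rw [sortType, sortType, elOfHLevel_subst, appArgs_subst]
  | iso K =>
    rw [sortType, sortType]
    split_ifs with hK
    · rw [subst, ih _ (rank_lt_of_mem_hom (L.src_mem hK)) _ _ _ _ rfl]
    · rfl
  | rho K =>
    rw [sortType, sortType]
    split_ifs with hK
    · rw [subst, subst, ih _ (rank_lt_of_mem_hom (L.src_rfl_mem hK)) _ _ _ _ rfl, subst]
    · rfl
  | tau f =>
    rw [sortType, sortType]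
    split_ifs with hf
    · have hlt := rank_lt_of_mem_hom (L.fst_mem hf)
      rw [subst, ih _ hlt _ _ _ _ rfl, transport_subst, ih _ hlt _ _ _ _ rfl]
      simp only [lift_subst_ups]
      -- In the family of the transport, position `f` holds the bound variable, which `ups σ` fixes;
      -- the other positions are lifted terms.
      congr 3
      funext p
      split_ifs
      · rfl
      · exact lift_subst_ups _ _
    · rfl

theorem sortType_lift (K : Ob O M) (env : Ob O M → Expr) (a : Mor O M → Expr) :
    (L.sortType K env a).lift = L.sortType K (fun N => (env N).lift) fun f => (a f).lift := by
  simp only [lift_eq_subst, sortType_subst]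

variable {L} in
theorem appArgs_congr {K : Ob O M} {k : Expr} {a a' : Mor O M → Expr}
    (ha : ∀ f ∈ L.out K, a f = a' f) : L.appArgs K k a = L.appArgs K k a' := by
  unfold appArgs
  split
  · rfl
  · refine List.foldl_ext _ _ _ fun e f hf => ?_
    rw [ha f (mem_of_mem_sortedList hf)]

variable {L} in
/-- The interpretation of `K` depends only on the arguments indexed by `K // L` and on the
interpretation of the non-logical sorts in the support of `K`. -/
theorem sortType_congr {K : Ob O M} {env env' : Ob O M → Expr} {a a' : Mor O M → Expr}
    (henv : ∀ N ∈ L.support K, env N = env' N) (ha : ∀ f ∈ L.out K, a f = a' f) :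
    L.sortType K env a = L.sortType K env' a' := by
  induction hr : L.rank K using Nat.strong_induction_on generalizing K env env' a a' with
  | _ r ih =>
  subst hr
  -- Both hypotheses pass from `K` to the target of an arrow out of `K`, with arguments precomposed
  -- with that arrow.
  have step : ∀ {K' : Ob O M} {f : Mor O M}, f ∈ L.hom K K' → (∀ N ∈ L.support K', env N = env' N) ∧
      ∀ p ∈ L.out K', a (L.comp p f) = a' (L.comp p f) := by
    rintro K' f ⟨hf, hd, rfl⟩
    have hf' : f ∈ L.out K := ⟨hf, hd⟩
    exact ⟨fun N hN => henv N (support_cod_subset hf' hN), fun p hp => ha _ (comp_mem_out hf' hp)⟩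
  cases K with
  | base A =>
    rw [sortType, sortType, henv (.base A) ⟨trivial, .inl rfl⟩, appArgs_congr ha]
  | iso K =>
    rw [sortType, sortType]
    split_ifs with hK
    · have hs := L.src_mem hK
      rw [ih _ (rank_lt_of_mem_hom hs) (step hs).1 (step hs).2 rfl,
        ha _ (mem_out_of_mem_hom hs), ha _ (mem_out_of_mem_hom (L.tgt_mem hK))]
    · rfl
  | rho K =>
    rw [sortType, sortType]
    split_ifs with hK
    · have hs := L.src_rfl_mem hK
      rw [ih _ (rank_lt_of_mem_hom hs) (step hs).1 (step hs).2 rfl, ← L.rho_comp K hK,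
        ha _ (mem_out_of_mem_hom hs), ha _ (mem_out_of_mem_hom (L.rfl_mem hK))]
    · rfl
  | tau f =>
    rw [sortType, sortType]
    split_ifs with hf
    · have h₁ := L.fst_mem hf
      have h₂ := L.snd_mem hf
      have hf' : f ∈ L.out (L.dom f) := ⟨(L.tau_mem f hf).1, rfl⟩
      rw [ih _ (rank_lt_of_mem_hom h₂) (step h₂).1 (step h₂).2 rfl,
        ha _ (mem_out_of_mem_hom h₁), ha _ (mem_out_of_mem_hom h₂),
        ha _ (mem_out_of_mem_hom (L.path_mem hf)), (step h₁).2 f hf', (step h₂).2 f hf',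
        ih (env := fun N => (env N).lift) (env' := fun N => (env' N).lift) _
          (rank_lt_of_mem_hom h₁) (fun N hN => congrArg lift ((step h₁).1 N hN)) _ rfl]
      intro p hp
      split_ifs
      · rfl
      · rw [(step h₁).2 p hp]
    · rfl

theorem piOut_subst (m : ℕ∞) (fs : List (Mor O M)) (env : Ob O M → Expr) (a : Mor O M → Expr)
    (σ : ℕ → Expr) :
    (L.piOut m env a fs).subst σ =
      L.piOut m (fun N => (env N).subst σ) (fun f => (a f).subst σ) fs := by
  induction fs generalizing env a σ with
  | nil => exact typesOfHLevel_subst m σ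
  | cons f fs ih =>
    simp only [piOut, subst, sortType_subst, ih, lift_subst_ups]
    congr 2
    funext g
    split_ifs
    · rfl
    · exact lift_subst_ups _ _

theorem familyType_subst (K : Ob O M) (env : Ob O M → Expr) (σ : ℕ → Expr) :
    (L.familyType K env).subst σ = L.familyType K fun N => (env N).subst σ := by
  unfold familyType
  split
  · rw [arrow_subst, typesOfHLevel_subst]; rfl
  · exact piOut_subst ..

theorem familyType_lift (K : Ob O M) (env : Ob O M → Expr) :
    (L.familyType K env).lift = L.familyType K fun N => (env N).lift := by
  simp only [lift_eq_subst, familyType_subst]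

variable {L} in
theorem piOut_congr {K : Ob O M} {m : ℕ∞} {fs : List (Mor O M)} {env env' : Ob O M → Expr}
    {a : Mor O M → Expr} (hfs : ∀ f ∈ fs, f ∈ L.out K)
    (henv : ∀ N, N.NonLogical → N ∈ L.cod '' L.out K → env N = env' N) :
    L.piOut m env a fs = L.piOut m env' a fs := by
  induction fs generalizing env env' a with
  | nil => rfl
  | cons f fs ih =>
    rw [piOut, piOut, ih (env := fun N => (env N).lift) (env' := fun N => (env' N).lift)
      (fun g hg => hfs g (.tail _ hg)) fun N hN hN' => congrArg lift (henv N hN hN'),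
      sortType_congr (env := env) (env' := env') (fun N hN => henv N hN.1
        (support_cod_subset_image (hfs f (.head _)) hN)) fun _ _ => rfl]

variable {L} in
theorem familyType_congr {K : Ob O M} {env env' : Ob O M → Expr}
    (henv : ∀ N, N.NonLogical → N ∈ L.cod '' L.out K → env N = env' N) :
    L.familyType K env = L.familyType K env' := by
  unfold familyType
  split
  · rfl
  · exact piOut_congr (fun f hf => mem_of_mem_sortedList hf) henv

open Classical in
theorem sigmaSorts_cons_cons (K K' : Ob O M) (Ks : List (Ob O M)) (env : Ob O M → Expr) :
    L.sigmaSorts env (K :: K' :: Ks) = .sigma (L.familyType K env)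
      (L.sigmaSorts (fun N => if N = K then .var 0 else (env N).lift) (K' :: Ks)) := rfl

theorem sigmaSorts_subst (Ks : List (Ob O M)) (env : Ob O M → Expr) (σ : ℕ → Expr) :
    (L.sigmaSorts env Ks).subst σ = L.sigmaSorts (fun N => (env N).subst σ) Ks := by
  induction Ks generalizing env σ with
  | nil => rfl
  | cons K Ks ih =>
    cases Ks with
    | nil => exact familyType_subst ..
    | cons K' Ks =>
      rw [sigmaSorts_cons_cons, sigmaSorts_cons_cons, subst, familyType_subst, ih]
      congr 2
      funext N
      split_ifs
      · rfl
      · exact lift_subst_ups _ _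

end HSignature

-- Interpreted sorts are types

namespace HSignature

variable {O : Type u} {M : Type v} (L : HSignature O M)

open HoTT (Derivable)
open HoTT.Judgment

/-- The terms `env` interpret the non-logical sorts in `S` over the context `Γ`. -/
def IsStruct (Γ : List Expr) (env : Ob O M → Expr) (S : Set (Ob O M)) : Prop :=
  ∀ N ∈ S, Derivable (tm Γ (env N) (L.familyType N env))

/-- The terms `a` are arguments of the sort `K` over the context `Γ`. -/
def IsArgs (Γ : List Expr) (env : Ob O M → Expr) (K : Ob O M) (a : Mor O M → Expr) : Prop :=
  ∀ f ∈ L.out K, Derivable (tm Γ (a f) (L.sortType (L.cod f) env fun p => a (L.comp p f)))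

variable {L}

theorem IsStruct.lift {Γ : List Expr} {env : Ob O M → Expr} {S : Set (Ob O M)} {B : Expr}
    (h : L.IsStruct Γ env S) (hB : Derivable (ok (B :: Γ))) :
    L.IsStruct (B :: Γ) (fun N => (env N).lift) S := fun N hN => by
  simpa only [familyType_lift] using Derivable.wkTm hB (h N hN)

theorem IsArgs.lift {Γ : List Expr} {env : Ob O M → Expr} {K : Ob O M} {a : Mor O M → Expr}
    {B : Expr} (h : L.IsArgs Γ env K a) (hB : Derivable (ok (B :: Γ))) :
    L.IsArgs (B :: Γ) (fun N => (env N).lift) K (fun f => (a f).lift) := fun f hf => by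
  simpa only [sortType_lift] using Derivable.wkTm hB (h f hf)

/-- By associativity, the type required of `a_{pf}` as an argument of `K` is the one required of it
as the argument at `p` of `K'`. -/
theorem IsArgs.comp {Γ : List Expr} {env : Ob O M → Expr} {K K' : Ob O M} {a : Mor O M → Expr}
    (h : L.IsArgs Γ env K a) {f : Mor O M} (hf : f ∈ L.hom K K') :
    L.IsArgs Γ env K' fun p => a (L.comp p f) := by
  obtain ⟨hf, hd, rfl⟩ := hf
  intro p hp
  have key := h _ (comp_mem_out ⟨hf, hd⟩ hp)
  rw [L.cod_comp f hf p hp.1 hp.2.symm] at key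
  rwa [sortType_congr (fun _ _ => rfl) fun q hq => ?_]
  rw [L.assoc f hf p hp.1 q hq.1 hp.2.symm hq.2.symm]

open Classical in
/-- The argument indexed by a top-level arrow can be changed freely. -/
theorem IsArgs.update {Γ : List Expr} {env : Ob O M → Expr} {K : Ob O M} {a : Mor O M → Expr}
    (h : L.IsArgs Γ env K a) {f : Mor O M} (hf : f ∈ L.top K) {y : Expr}
    (hy : Derivable (tm Γ y (L.sortType (L.cod f) env fun p => a (L.comp p f)))) :
    L.IsArgs Γ env K fun p => if p = f then y else a p := by
  intro p hp
  -- As `f` is top-level it is no composite `qp`, so the type of every argument, including the one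
  -- at `f`, ignores position `f`.
  rw [sortType_congr (a' := fun q => a (L.comp q p)) (fun _ _ => rfl) fun q hq =>
    if_neg fun e => hf.2 ⟨p, hp.1, q, hq.1, hq.2.symm, e.symm⟩]
  dsimp only
  split_ifs with e
  · rwa [e]
  · exact h p hp

/-- Here `fs` lists the arguments still to be supplied, and `b` agrees with `a` on those already
supplied. The domain for the next arrow `f` mentions only composites `pf`, which precede `f` and
hence are not in `fs`; so `a_f` has this type. The application substitutes `a_f` for the bound
variable, which updates `b` at `f`. -/
theorem foldl_app_tm {Γ : List Expr} {env : Ob O M → Expr} {K : Ob O M} {a : Mor O M → Expr}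
    (ha : L.IsArgs Γ env K a) {m : ℕ∞} {fs : List (Mor O M)} (hfs : ∀ f ∈ fs, f ∈ L.out K)
    (hlt : fs.Pairwise L.morLt) {b : Mor O M → Expr} (hb : ∀ g ∈ L.out K, g ∉ fs → b g = a g)
    {k : Expr} (hk : Derivable (tm Γ k (L.piOut m env b fs))) :
    Derivable (tm Γ (fs.foldl (fun e f => Expr.app e (a f)) k) (typesOfHLevel m)) := by
  classical
  induction fs generalizing b k with
  | nil => exact hk
  | cons f fs ih =>
    have hf := hfs f (.head _)
    have hfs' : ∀ g ∈ fs, g ∈ L.out K := fun g hg => hfs g (.tail _ hg)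
    obtain ⟨hlt₁, hlt₂⟩ := List.pairwise_cons.1 hlt
    refine ih hfs' hlt₂ (b := fun g => if g = f then a f else b g) (fun g hg hg' => ?_) ?_
    · split_ifs with e
      · rw [e]
      · exact hb g hg fun h => (List.mem_cons.1 h).elim e hg'
    · have haf := ha f hf
      rw [sortType_congr (a' := fun p => b (L.comp p f)) (fun _ _ => rfl) fun p hp =>
        (hb _ (comp_mem_out hf hp) (comp_notMem_cons hf hfs' hlt₁ hp)).symm] at haf
      have key := Derivable.piElim hk haf
      rw [inst, piOut_subst] at key
      convert key using 3
      · funext N; exact (lift_inst _ _).symm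
      · funext g
        split_ifs
        · rfl
        · exact (lift_inst _ _).symm

theorem appArgs_tm {Γ : List Expr} {env : Ob O M → Expr} {K : Ob O M} {a : Mor O M → Expr}
    (hΓ : Derivable (ok Γ)) (hK : K ∈ L.ob) (ha : L.IsArgs Γ env K a) {k : Expr}
    (hk : Derivable (tm Γ k (L.familyType K env))) :
    Derivable (tm Γ (L.appArgs K k a) (typesOfHLevel (L.h K))) := by
  obtain ⟨hlt, hmem⟩ := L.outList_spec hK
  unfold familyType at hk
  unfold appArgs
  cases hl : L.outList K with
  | nil =>
    rw [hl] at hk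
    exact Derivable.arrowElim hk (.unitIntro hΓ)
  | cons f fs =>
    rw [hl] at hk
    -- Initially every arrow out of `K` is still to be supplied, so nothing is asked of the default
    -- `star`.
    refine foldl_app_tm ha (fun g hg => ?_) (hl ▸ hlt) (fun g hg hg' => ?_) hk
    · exact (hmem g).1 (hl ▸ hg)
    · exact (hg' (hl ▸ (hmem g).2 hg)).elim

/-- The interpretation of a sort at arguments of that sort is a type. -/
theorem sortType_ty {Γ : List Expr} {env : Ob O M → Expr} {K : Ob O M} {a : Mor O M → Expr}
    (hΓ : Derivable (ok Γ)) (hK : K ∈ L.ob) (henv : L.IsStruct Γ env (L.support K))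
    (ha : L.IsArgs Γ env K a) : Derivable (ty Γ (L.sortType K env a)) := by
  -- The context varies in the induction: transport sorts use the hypothesis over extensions of `Γ`.
  induction hr : L.rank K using Nat.strong_induction_on generalizing K Γ env a with
  | _ r ih =>
  subst hr
  have supp : ∀ {K' : Ob O M} {f : Mor O M}, f ∈ L.hom K K' → L.support K' ⊆ L.support K := by
    rintro K' f ⟨hf, hd, rfl⟩
    exact support_cod_subset ⟨hf, hd⟩
  have ob : ∀ {K' : Ob O M} {f : Mor O M}, f ∈ L.hom K K' → K' ∈ L.ob := by
    rintro K' f ⟨hf, hd, rfl⟩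
    exact L.cod_mem f hf
  have sub : ∀ {K' : Ob O M} {f : Mor O M}, f ∈ L.hom K K' →
      Derivable (ty Γ (L.sortType K' env fun p => a (L.comp p f))) := fun hf =>
    ih _ (rank_lt_of_mem_hom hf) hΓ (ob hf) (fun N hN => henv N (supp hf hN)) (ha.comp hf) rfl
  have arg : ∀ {K' : Ob O M} {f : Mor O M}, f ∈ L.hom K K' →
      Derivable (tm Γ (a f) (L.sortType K' env fun p => a (L.comp p f))) := by
    rintro K' f ⟨hf, hd, rfl⟩
    exact ha f ⟨hf, hd⟩
  cases K with
  | base A =>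
    rw [sortType]
    exact .elOfHLevelForm _ (appArgs_tm hΓ hK ha (henv _ ⟨trivial, .inl rfl⟩))
  | iso K =>
    rw [sortType, dif_pos hK]
    have hs := L.src_mem hK
    refine .idForm (sub hs) (arg hs) ?_
    -- The equations `p s_K = p t_K` put both endpoints in the same type.
    rw [sortType_congr (fun _ _ => rfl) fun p hp => ?_]
    · exact arg (L.tgt_mem hK)
    · rw [L.iso_comp K hK p hp]
  | rho K =>
    -- By `s_K r_K = t_K r_K` the inner identity type consists of loops, so it contains `refl`.
    rw [sortType, dif_pos hK, ← L.rho_comp K hK]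
    have hs := L.src_rfl_mem hK
    have hr := L.rfl_mem hK
    have hiso := L.iso_mem_of_rho_mem hK
    refine .idForm (.idForm (sub hs) (arg hs) (arg hs)) ?_ (.idIntro (arg hs))
    have key := arg hr
    rw [sortType, dif_pos hiso, ← L.rho_comp K hK] at key
    rwa [sortType_congr (fun _ _ => rfl) fun p hp => ?_]
    have hs' := L.src_mem hiso
    rw [L.assoc _ hr.1 _ hs'.1 p hp.1 (hr.2.2.trans hs'.2.1.symm) (hs'.2.2.trans hp.2.symm)]
  | tau f =>
    classical
    rw [sortType, dif_pos hK]
    have h₁ := L.fst_mem hK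
    have h₂ := L.snd_mem hK
    have he := L.path_mem hK
    have hiso := ob he
    have hs := L.src_mem hiso
    obtain ⟨hf, htop⟩ := L.tau_mem f hK
    have hcomp : ∀ {k}, k ∈ L.hom (.tau f) (L.dom f) → L.comp f k ∈ L.hom (.tau f) (L.cod f) :=
      fun hk => ⟨L.comp_mem _ hk.1 _ hf hk.2.2, (L.dom_comp _ hk.1 _ hf hk.2.2).trans hk.2.1,
        L.cod_comp _ hk.1 _ hf hk.2.2⟩
    have hassoc : ∀ {k}, k ∈ L.hom (.tau f) (L.dom f) → ∀ q ∈ L.out (L.cod f),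
        L.comp (L.comp q f) k = L.comp q (L.comp f k) := fun hk q hq =>
      (L.assoc _ hk.1 _ hf q hq.1 hk.2.2 hq.2.symm).symm
    refine .idForm (sub h₂) (arg h₂) ?_
    -- The transport takes place in the family `P` over `T`: only position `f` of the first tuple of
    -- arguments varies.
    set T := L.sortType (L.cod f) env fun q => a (L.comp q (L.comp f (.fst f))) with hT
    set P := L.sortType (L.dom f) (fun N => (env N).lift)
      fun p => if p = f then Expr.var 0 else (a (L.comp p (.fst f))).lift with hPdef
    have hTty : Derivable (ty Γ T) := sub (hcomp h₁)
    have hctx₁ : Derivable (ok (T :: Γ)) := .cons hΓ hTty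
    have hctx₂ : Derivable (ok (T.lift :: T :: Γ)) := .cons hctx₁ (.wkTy hctx₁ hTty)
    have hctx₃ := Derivable.cons hctx₂ (.pathForm hΓ hTty)
    have hPinst : ∀ t, P.inst t =
        L.sortType (L.dom f) env fun p => if p = f then t else a (L.comp p (.fst f)) := by
      intro t
      rw [hPdef, inst, sortType_subst]
      congr 1
      · funext N; exact lift_inst _ _
      · funext p
        split_ifs
        · rfl
        · exact lift_inst _ _
    -- This serves `P` and its two copies in the motive alike. Each is the interpretation of `A`,
    -- the source of `f`, with position `f` updated, over its own context.
    have family : ∀ {Δ : List Expr} {env' : Ob O M → Expr} {b : Mor O M → Expr} {y : Expr},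
        Derivable (ok Δ) → L.IsStruct Δ env' (L.support (.tau f)) →
        L.IsArgs Δ env' (L.dom f) b →
        Derivable (tm Δ y (L.sortType (L.cod f) env' fun q => b (L.comp q f))) →
        Derivable (ty Δ (L.sortType (L.dom f) env' fun p => if p = f then y else b p)) :=
      fun hΔ henv' hb hy => ih _ (rank_lt_of_mem_hom h₁) hΔ (ob h₁)
        (fun N hN => henv' N (supp h₁ hN)) (hb.update htop hy) rfl
    have hTeq : L.sortType (L.cod f) env (fun q => a (L.comp (L.comp q f) (.fst f))) = T :=
      sortType_congr (fun _ _ => rfl) fun q hq => by rw [hassoc h₁ q hq]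
    have hlift₃ : ∀ (e : Expr) (σ : ℕ → Expr), (∀ i, σ (i + 1) = .var (i + 3)) →
        e.lift.subst σ = e.lift.lift.lift := by
      intro e σ hσ
      simp only [lift_eq_subst, subst_subst, subst, hσ]
    -- The motive lives over three new variables (two points and a path). The bound variable of `P`
    -- becomes one of the points, and everything from `Γ` is lifted three times.
    have hPsubst : ∀ σ : ℕ → Expr, (∀ i, σ (i + 1) = .var (i + 3)) → P.subst σ =
        L.sortType (L.dom f) (fun N => (env N).lift.lift.lift) fun p =>
          if p = f then σ 0 else (a (L.comp p (.fst f))).lift.lift.lift := by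
      intro σ hσ
      rw [hPdef, sortType_subst]
      congr 1
      · funext N; exact hlift₃ _ σ hσ
      · funext p
        split_ifs
        · rfl
        · exact hlift₃ _ σ hσ
    have hargs := ha.comp h₁
    have hT₃ : L.sortType (L.cod f) (fun N => (env N).lift.lift.lift)
        (fun q => (a (L.comp (L.comp q f) (.fst f))).lift.lift.lift) = T.lift.lift.lift := by
      rw [← hTeq, sortType_lift, sortType_lift, sortType_lift]
    have hbase : ∀ q ∈ L.out (L.cod f), a (L.comp q (L.comp f (.fst f))) =
        a (L.comp q (L.comp f (.snd f))) := fun q hq => by rw [L.tau_base f hK q hq]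
    -- The transported term lands in the type of `a_{f₂}`, because `p f₁ = p f₂` for all `p ≠ f`.
    have hres : P.inst (a (L.comp f (.snd f))) =
        L.sortType (L.dom f) env fun p => a (L.comp p (.snd f)) := by
      rw [hPinst]
      refine sortType_congr (fun _ _ => rfl) fun p hp => ?_
      split_ifs with e
      · rw [e]
      · rw [L.tau_other f hK p hp e]
    rw [← hres]
    refine .transportForm hΓ hTty ?_ ?_ ?_ (arg (hcomp h₁)) ?_ ?_ ?_
    · refine family hctx₁ (henv.lift hctx₁) (hargs.lift hctx₁) ?_
      rw [← L.sortType_lift, hTeq]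
      exact .var hctx₁
    · rw [hPsubst _ fun i => rfl]
      refine family hctx₃ (((henv.lift hctx₁).lift hctx₂).lift hctx₃)
        (((hargs.lift hctx₁).lift hctx₂).lift hctx₃) ?_
      rw [hT₃]
      exact .wkTm hctx₃ (.wkTm hctx₂ (.var hctx₁))
    · rw [hPsubst _ fun i => rfl]
      refine family hctx₃ (((henv.lift hctx₁).lift hctx₂).lift hctx₃)
        (((hargs.lift hctx₁).lift hctx₂).lift hctx₃) ?_
      rw [hT₃]
      exact .wkTm hctx₃ (.var hctx₂)
    -- The second endpoint lies in `T` by `q f f₁ = q f f₂`.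
    · rw [hT, sortType_congr (fun _ _ => rfl) hbase]
      exact arg (hcomp h₂)
    -- The argument at `e_f` is a path between the right endpoints by `s e_f = f f₁` and `t e_f = f
    -- f₂`.
    · have key := arg he
      rw [sortType, dif_pos hiso, L.tau_src f hK, L.tau_tgt f hK] at key
      rwa [hT, sortType_congr (fun _ _ => rfl) fun q hq => ?_]
      rw [← L.tau_src f hK, L.assoc _ he.1 _ hs.1 q hq.1 (he.2.2.trans hs.2.1.symm)
        (hs.2.2.trans hq.2.symm)]
    · rw [hPinst, sortType_congr (fun _ _ => rfl) fun p hp => ?_]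
      · exact arg h₁
      · split_ifs with e
        · rw [e]
        · rfl

-- The types `T_K` and the type of structures

/-- The invariant: the arrows out of `K` missing from `fs` are those already declared, they precede
all of `fs`, and `a` gives them terms of the right types. The next domain needs only composites,
which are among them. -/
theorem piOut_ty {K : Ob O M} {m : ℕ∞} {fs : List (Mor O M)} {Γ : List Expr}
    {env : Ob O M → Expr} {a : Mor O M → Expr} (hΓ : Derivable (ok Γ))
    (henv : L.IsStruct Γ env {N | N.NonLogical ∧ N ∈ L.cod '' L.out K})
    (hfs : ∀ f ∈ fs, f ∈ L.out K) (hlt : fs.Pairwise L.morLt)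
    (hbelow : ∀ g ∈ L.out K, g ∉ fs → ∀ f ∈ fs, L.morLt g f)
    (ha : ∀ g ∈ L.out K, g ∉ fs →
      Derivable (tm Γ (a g) (L.sortType (L.cod g) env fun p => a (L.comp p g)))) :
    Derivable (ty Γ (L.piOut m env a fs)) := by
  induction fs generalizing Γ env a with
  | nil => exact .typesOfHLevelForm m hΓ
  | cons f fs ih =>
    have hf := hfs f (.head _)
    have hfs' : ∀ g ∈ fs, g ∈ L.out K := fun g hg => hfs g (.tail _ hg)
    obtain ⟨hlt₁, hlt₂⟩ := List.pairwise_cons.1 hlt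
    have hTty : Derivable (ty Γ (L.sortType (L.cod f) env fun p => a (L.comp p f))) := by
      refine sortType_ty hΓ (L.cod_mem f hf.1)
        (fun N hN => henv N ⟨hN.1, support_cod_subset_image hf hN⟩) fun p hp => ?_
      have key := ha _ (comp_mem_out hf hp) (comp_notMem_cons hf hfs' hlt₁ hp)
      rw [L.cod_comp f hf.1 p hp.1 hp.2.symm] at key
      rwa [sortType_congr (fun _ _ => rfl) fun q hq => ?_]
      rw [L.assoc f hf.1 p hp.1 q hq.1 hp.2.symm hq.2.symm]
    have hctx := Derivable.cons hΓ hTty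
    rw [piOut]
    refine .piForm hTty (ih hctx (henv.lift hctx) hfs' hlt₂ (fun g hg hg' k hk => ?_)
      fun g hg hg' => ?_)
    · by_cases e : g = f
      · exact e ▸ hlt₁ k hk
      · exact hbelow g hg (by simp [e, hg']) k (.tail _ hk)
    -- For `g` declared so far, `f` included, `pg < g ≤ f`. So the new variable for `f` does not
    -- disturb the types of the declared arguments.
    · have hne : ∀ p ∈ L.out (L.cod g), L.comp p g ≠ f := fun p hp e => by
        have h₁ := comp_morLt hg hp
        rw [e] at h₁
        by_cases e' : g = f
        · exact L.morLt_irrefl f hf.1 (e' ▸ h₁)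
        · exact L.morLt_irrefl f hf.1 (L.morLt_trans f hf.1 g hg.1 f hf.1 h₁
            (hbelow g hg (by simp [e', hg']) f (.head _)))
      rw [sortType_congr (a' := fun p => (a (L.comp p g)).lift) (fun _ _ => rfl)
        fun p hp => if_neg (hne p hp)]
      split_ifs with e
      · subst e
        have := Derivable.var hctx
        rwa [sortType_lift] at this
      · have := Derivable.wkTm hctx (ha g hg (by simp [e, hg']))
        rwa [sortType_lift] at this

theorem familyType_ty {K : Ob O M} (hK : K ∈ L.ob) {Γ : List Expr} {env : Ob O M → Expr}
    (hΓ : Derivable (ok Γ))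
    (henv : L.IsStruct Γ env {N | N.NonLogical ∧ N ∈ L.cod '' L.out K}) :
    Derivable (ty Γ (L.familyType K env)) := by
  obtain ⟨hlt, hmem⟩ := L.outList_spec hK
  unfold familyType
  split
  · exact .arrowForm hΓ (.unitForm hΓ) (.typesOfHLevelForm _ hΓ)
  · exact piOut_ty hΓ henv (fun f hf => (hmem f).1 hf) hlt
      (fun g hg hg' => (hg' ((hmem g).2 hg)).elim) fun g hg hg' => (hg' ((hmem g).2 hg)).elim

/-- The sorts on which the head of an increasing list of sorts depends do not occur in the list. -/
theorem notMem_cons_of_mem_image {K N : Ob O M} {Ks : List (Ob O M)} (hK : K ∈ L.ob)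
    (hKs : ∀ K' ∈ Ks, K' ∈ L.ob) (hlt : ∀ K' ∈ Ks, L.obLt K K') (hN : N ∈ L.cod '' L.out K) :
    N ∉ K :: Ks := by
  have hNK := obLt_of_mem_image hN
  intro h
  rcases List.mem_cons.1 h with rfl | h
  · exact L.obLt_irrefl _ hK hNK
  · exact L.obLt_irrefl _ hK (L.obLt_trans _ hK _ (hKs _ h) _ hK (hlt _ h) hNK)

/-- The argument of `piOut_ty` with sorts in place of arrows: `T_K` for the head `K` mentions only
sorts below `K`, and these are already declared. The list with one member is a separate case, since
the sum has no trailing factor. -/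
theorem sigmaSorts_ty {Ks : List (Ob O M)} {Γ : List Expr} {env : Ob O M → Expr}
    (hΓ : Derivable (ok Γ)) (hKs : ∀ K ∈ Ks, K ∈ L.nonLogical) (hlt : Ks.Pairwise L.obLt)
    (hbelow : ∀ N ∈ L.nonLogical, N ∉ Ks → ∀ K ∈ Ks, L.obLt N K)
    (henv : L.IsStruct Γ env {N | N ∈ L.nonLogical ∧ N ∉ Ks}) :
    Derivable (ty Γ (L.sigmaSorts env Ks)) := by
  induction Ks generalizing Γ env with
  | nil => exact .emptyForm hΓ
  | cons K Ks ih =>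
    have hK := hKs K (.head _)
    have hKs' : ∀ N ∈ Ks, N ∈ L.nonLogical := fun N hN => hKs N (.tail _ hN)
    obtain ⟨hlt₁, hlt₂⟩ := List.pairwise_cons.1 hlt
    have hTty : Derivable (ty Γ (L.familyType K env)) :=
      familyType_ty hK.1 hΓ fun N hN => henv N ⟨⟨ob_of_mem_image hN.2, hN.1⟩,
        notMem_cons_of_mem_image hK.1 (fun N hN => (hKs' N hN).1) hlt₁ hN.2⟩
    cases Ks with
    | nil => exact hTty
    | cons K' Ks =>
      have hctx := Derivable.cons hΓ hTty
      rw [sigmaSorts_cons_cons]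
      refine .sigmaForm hTty (ih hctx hKs' hlt₂ (fun N hN hN' N' hN'' => ?_) ?_)
      · by_cases e : N = K
        · exact e ▸ hlt₁ N' hN''
        · exact hbelow N hN (fun h => (List.mem_cons.1 h).elim e hN') N' (.tail _ hN'')
      · rintro N ⟨hN, hN'⟩
        have hne : ∀ N', N'.NonLogical → N' ∈ L.cod '' L.out N → N' ≠ K := by
          rintro N' - hN'' rfl
          have h₁ := obLt_of_mem_image hN''
          by_cases e : N = N'
          · exact L.obLt_irrefl _ hK.1 (e ▸ h₁)
          · exact L.obLt_irrefl _ hK.1 (L.obLt_trans _ hK.1 _ hN.1 _ hK.1 h₁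
              (hbelow N hN (fun h => (List.mem_cons.1 h).elim e hN') _ (.head _)))
        rw [familyType_congr (env' := fun N => (env N).lift) fun N' h h' => if_neg (hne N' h h'),
          ← familyType_lift]
        dsimp only
        split_ifs with e
        · rw [e]; exact .var hctx
        · exact .wkTm hctx (henv N ⟨hN, fun h => (List.mem_cons.1 h).elim e hN'⟩)

open Classical in
theorem projAt_cons_cons (N K K' : Ob O M) (Ks : List (Ob O M)) (t : Expr) :
    projAt N (K :: K' :: Ks) t = if N = K then .fst t else projAt N (K' :: Ks) (.snd t) := rfl

-- The type of `snd t` is the remaining sum with `fst t` substituted for the variable `K`. The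
-- induction hypothesis thus applies with an environment that sends `K` to `fst t`, and `heq`
-- identifies the result with the projections of `t`.
open Classical in
theorem projAt_tm {Ks : List (Ob O M)} {Γ : List Expr} {env : Ob O M → Expr} {t : Expr}
    (hKs : ∀ K ∈ Ks, K ∈ L.ob) (hlt : Ks.Pairwise L.obLt)
    (ht : Derivable (tm Γ t (L.sigmaSorts env Ks))) :
    L.IsStruct Γ (fun N => if N ∈ Ks then projAt N Ks t else env N) {N | N ∈ Ks} := by
  induction Ks generalizing env t with
  | nil => intro N hN; simp at hN
  | cons K Ks ih =>
    have hK := hKs K (.head _)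
    have hKs' : ∀ N ∈ Ks, N ∈ L.ob := fun N hN => hKs N (.tail _ hN)
    obtain ⟨hlt₁, hlt₂⟩ := List.pairwise_cons.1 hlt
    have head : L.familyType K (fun N => if N ∈ K :: Ks then projAt N (K :: Ks) t else env N) =
        L.familyType K env :=
      familyType_congr fun N _ hN => if_neg (notMem_cons_of_mem_image hK hKs' hlt₁ hN)
    cases Ks with
    | nil =>
      intro N hN
      obtain rfl : N = K := by simpa using hN
      rw [head]
      simpa [projAt, sigmaSorts] using ht
    | cons K' Ks =>
      rw [sigmaSorts_cons_cons] at ht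
      have hsnd := Derivable.sigmaSnd ht
      rw [inst, sigmaSorts_subst] at hsnd
      have key := ih hKs' hlt₂ hsnd
      have hKnot : K ∉ K' :: Ks := fun h => L.obLt_irrefl K hK (hlt₁ K h)
      have heq : (fun N => if N ∈ K :: K' :: Ks then projAt N (K :: K' :: Ks) t else env N) =
          fun N => if N ∈ K' :: Ks then projAt N (K' :: Ks) (.snd t) else
            (if N = K then Expr.var 0 else (env N).lift).subst fun
              | 0 => .fst t
              | i + 1 => .var i := by
        funext N
        rw [projAt_cons_cons]
        by_cases e : N = K
        · subst e
          rw [if_pos (.head _), if_pos rfl, if_neg hKnot, if_pos rfl]; rfl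
        · by_cases h : N ∈ K' :: Ks
          · rw [if_pos (.tail _ h), if_neg e, if_pos h]
          · rw [if_neg fun h' => (List.mem_cons.1 h').elim e h, if_neg h, if_neg e]
            exact (lift_inst _ _).symm
      intro N hN
      by_cases e : N = K
      · subst e
        rw [head]
        dsimp only
        rw [if_pos (.head _), projAt_cons_cons, if_pos rfl]
        exact .sigmaFst ht
      · rw [heq]
        exact key N ((List.mem_cons.1 hN).resolve_left e)

end HSignature

-- Contexts and the induction on derivations

namespace HSignature

open HoTT (Derivable)
open HoTT.Judgment

variable {O : Type u} {M : Type v} {L : HSignature O M}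

theorem projAt_rename (N : Ob O M) (Ks : List (Ob O M)) (t : Expr) (ρ : ℕ → ℕ) :
    (projAt N Ks t).rename ρ = projAt N Ks (t.rename ρ) := by
  induction Ks generalizing t with
  | nil => rfl
  | cons K Ks ih =>
    cases Ks with
    | nil => rfl
    | cons K' Ks =>
      rw [projAt_cons_cons, projAt_cons_cons]
      split_ifs
      · rfl
      · exact ih _

theorem structEnv_rename {n m : ℕ} {ρ : ℕ → ℕ} (hρ : ρ n = m) (N : Ob O M) :
    (L.structEnv n N).rename ρ = L.structEnv m N := by
  rw [structEnv, projAt_rename, rename, hρ, structEnv]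

/-- Interpretation of sort expressions commutes with renaming, where `ρ n = m` is the variable that
denotes the structure. -/
theorem interpSort_rename {n m : ℕ} {ρ : ℕ → ℕ} (hρ : ρ n = m) (K : L.SortExpr) :
    L.interpSort m (K.rename ρ) = (L.interpSort n K).rename ρ := by
  rw [interpSort, interpSort, rename_eq_subst, sortType_subst]
  simp only [← rename_eq_subst]
  congr 1
  · funext N
    exact (structEnv_rename hρ N).symm
  · funext f
    by_cases hf : f ∈ L.out K.head
    · rw [dif_pos hf, dif_pos (show f ∈ L.out (K.rename ρ).head from hf)]; rfl
    · rw [dif_neg hf, dif_neg (show f ∉ L.out (K.rename ρ).head from hf)]; rfl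

theorem interpFormula_rename {n m : ℕ} {ρ : ℕ → ℕ} (hρ : ρ n = m) (φ : L.Formula) :
    L.interpFormula m (φ.rename ρ) = (L.interpFormula n φ).rename ρ := by
  induction φ generalizing n m ρ with
  | bot => rfl
  | top => rfl
  | and φ ψ ihφ ihψ =>
    rw [Formula.rename, interpFormula, interpFormula, prod_rename, ihφ hρ, ihψ hρ]
  | or φ ψ ihφ ihψ =>
    rw [Formula.rename, interpFormula, interpFormula, rename, rename, ihφ hρ, ihψ hρ]
  | imp φ ψ ihφ ihψ =>
    rw [Formula.rename, interpFormula, interpFormula, arrow_rename, ihφ hρ, ihψ hρ]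
  | all K φ ih =>
    have hρ' : upr ρ (n + 1) = m + 1 := congrArg (· + 1) hρ
    rw [Formula.rename, interpFormula, interpFormula, rename, interpSort_rename hρ, ih hρ']
  | ex K φ ih =>
    have hρ' : upr ρ (n + 1) = m + 1 := congrArg (· + 1) hρ
    rw [Formula.rename, interpFormula, interpFormula, rename, rename, interpSort_rename hρ, ih hρ']

/-- HoTT weakens by one declaration at a time; the intermediate contexts are valid by inversion. -/
theorem wkTy_interpCtx {Γ Δ : List L.SortExpr} {A : Expr}
    (hok : Derivable (ok (L.interpCtx (Δ ++ Γ)))) (hA : Derivable (ty (L.interpCtx Γ) A)) :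
    Derivable (ty (L.interpCtx (Δ ++ Γ)) (A.rename (· + Δ.length))) := by
  induction Δ with
  | nil => simpa only [List.nil_append, List.length_nil, rename_add_zero] using hA
  | cons K Δ ih =>
    rw [List.length_cons, ← lift_rename_add]
    exact .wkTy hok (ih (Derivable.ok_tail hok))

theorem wkTm_interpCtx {Γ Δ : List L.SortExpr} {a A : Expr}
    (hok : Derivable (ok (L.interpCtx (Δ ++ Γ)))) (ha : Derivable (tm (L.interpCtx Γ) a A)) :
    Derivable (tm (L.interpCtx (Δ ++ Γ)) (a.rename (· + Δ.length)) (A.rename (· + Δ.length))) := by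
  induction Δ with
  | nil => simpa only [List.nil_append, List.length_nil, rename_add_zero] using ha
  | cons K Δ ih =>
    rw [List.length_cons, ← lift_rename_add, ← lift_rename_add]
    exact .wkTm hok (ih (Derivable.ok_tail hok))

theorem hStruc_ok (hL : L.EssentiallyFinite) : Derivable (ok [L.hStruc]) := by
  obtain ⟨hlt, hmem⟩ := L.nonLogicalList_spec hL
  exact .cons .nil (sigmaSorts_ty .nil (fun K hK => (hmem K).1 hK) hlt
    (fun N hN hN' => (hN' ((hmem N).2 hN)).elim) fun N hN => (hN.2 ((hmem N).2 hN.1)).elim)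

/-- The components of the generic structure interpret the non-logical sorts. -/
theorem isStruct_structEnv (hL : L.EssentiallyFinite) {Γ : List L.SortExpr}
    (hΓ : Derivable (ok (L.interpCtx Γ))) :
    L.IsStruct (L.interpCtx Γ) (L.structEnv Γ.length) L.nonLogical := by
  induction Γ with
  | nil =>
    obtain ⟨hlt, hmem⟩ := L.nonLogicalList_spec hL
    intro N hN
    have hvar := Derivable.var hΓ
    rw [hStruc, lift_eq_subst, sigmaSorts_subst] at hvar
    have key := projAt_tm (fun K hK => ((hmem K).1 hK).1) hlt hvar N ((hmem N).2 hN)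
    dsimp only at key
    -- By essential finiteness every non-logical sort is listed, so the default environment of
    -- `hStruc` drops out.
    rw [if_pos ((hmem N).2 hN), familyType_congr (env' := fun N => projAt N L.nonLogicalList (.var 0))
      fun N' h h' => if_pos ((hmem N').2 ⟨ob_of_mem_image h', h⟩)] at key
    exact key
  | cons K Γ ih =>
    have h := (ih (Derivable.ok_tail hΓ)).lift hΓ
    have e : (fun N => (L.structEnv Γ.length N).lift) = L.structEnv (K :: Γ).length :=
      funext fun N => structEnv_rename rfl N
    rwa [e] at h

/-- The context of a judgment. -/
def context : L.Judgment → List L.SortExpr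
  | .ok Γ | .sort Γ _ | .var Γ _ _ | .formula Γ _ => Γ

/-- Validity of the context is added for the sake of the quantifiers: their premise over `K :: Γ`
then yields that the interpretation of `K` is a type. -/
theorem interp_derivable (hL : L.EssentiallyFinite) {S : L.Judgment} (hS : L.Derivable S) :
    Derivable (ok (L.interpCtx (context S))) ∧ Derivable (L.interp S) := by
  induction hS with
  | conEmpty => exact ⟨hStruc_ok hL, hStruc_ok hL⟩
  | conExt _ _ ihΓ ihK =>
    have h := Derivable.cons ihΓ.2 ihK.2
    exact ⟨h, h⟩
  | @conWk Γ Δ K _ _ ihΓ ihK =>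
    refine ⟨ihΓ.2, ?_⟩
    rw [interp, interpSort_rename (n := Γ.length) (by simp [add_comm])]
    exact wkTy_interpCtx ihΓ.2 ihK.2
  | @ax Γ Δ K _ ihΓ =>
    refine ⟨ihΓ.2, ?_⟩
    have hok : ∀ {Δ : List L.SortExpr}, Derivable (ok (L.interpCtx (Δ ++ K :: Γ))) →
        Derivable (ok (L.interpCtx (K :: Γ))) := by
      intro Δ h
      induction Δ with
      | nil => exact h
      | cons K' Δ ih => exact ih (Derivable.ok_tail h)
    have key := wkTm_interpCtx ihΓ.2 (Derivable.var (hok ihΓ.2))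
    -- The structure moves from index `|Γ|` to index `|Γ| + |Δ| + 1`.
    rw [interp, interpSort_rename (n := Γ.length) (by simp; omega)]
    rw [lift, rename_rename, rename, Nat.zero_add] at key
    convert key using 3
    funext i
    simp only [Nat.succ_eq_add_one]
    omega
  | @sortForm Γ K hK x _ _ ihΓ ihx =>
    refine ⟨ihΓ.2, sortType_ty ihΓ.2 hK
      (fun N hN => isStruct_structEnv hL ihΓ.2 N (support_subset_nonLogical hK hN))
      fun f hf => ?_⟩
    have key := (ihx ⟨f, hf⟩).2
    -- The arguments of `depSort` are those at composites with `f`, so both families agree on the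
    -- arrows out of the target of `f`; the default `star` elsewhere is immaterial.
    simp only [dif_pos hf]
    rwa [interp, interpSort, sortType_congr (fun _ _ => rfl) fun p hp => ?_] at key
    have hp' : p ∈ L.out (L.depSort x ⟨f, hf⟩).head := hp
    rw [dif_pos hp', dif_pos (comp_mem_out hf hp)]
    rfl
  | @formWk Γ Δ φ _ _ ihΓ ihφ =>
    refine ⟨ihΓ.2, ?_⟩
    rw [interp, interpFormula_rename (n := Γ.length) (by simp [add_comm])]
    exact wkTy_interpCtx ihΓ.2 ihφ.2
  | botForm _ ihΓ => exact ⟨ihΓ.2, .emptyForm ihΓ.2⟩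
  | topForm _ ihΓ => exact ⟨ihΓ.2, .unitForm ihΓ.2⟩
  | andForm _ _ _ ihΓ ihφ ihψ => exact ⟨ihΓ.2, .prodForm ihΓ.2 ihφ.2 ihψ.2⟩
  | orForm _ _ _ ihΓ ihφ ihψ => exact ⟨ihΓ.2, .truncForm (.sumForm ihφ.2 ihψ.2)⟩
  | impForm _ _ _ ihΓ ihφ ihψ => exact ⟨ihΓ.2, .arrowForm ihΓ.2 ihφ.2 ihψ.2⟩
  | allForm _ _ ihΓ ihφ => exact ⟨ihΓ.2, .piForm (Derivable.ty_head ihφ.1) ihφ.2⟩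
  | exForm _ _ ihΓ ihφ =>
    exact ⟨ihΓ.2, .truncForm (.sigmaForm (Derivable.ty_head ihφ.1) ihφ.2)⟩

end HSignature

end FOLIso

theorem mainTheorem2 {O : Type*} {M : Type*} (L : FOLIso.HSignature O M)
    (hL : L.EssentiallyFinite) (S : L.Judgment) (hS : L.Derivable S) :
    HoTT.Derivable (L.interp S) :=
  (FOLIso.HSignature.interp_derivable hL hS).2
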